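/- Let $M$ be a smooth manifold of dimension $n\ge 1$ with a smooth Riemannian metric $g$ with Levi-Civita connection $\nabla$ and Christoffel symbols $\Gamma^h_{ij}$, and let $f\in C^\infty(M)$ with $f>0$. Let $\pi:T^*M\to M$ be the cotangent bundle with the coordinates $(x^i,p_i)$ induced by local coordinates $(x^i)$ of $M$; write $\partial_i=\partial/\partial x^i$ and $\partial_{\bar i}=\partial/\partial p_i$. For a vector field $X=X^i\partial_i$ and a $1$-form $\omega=\omega_i\,dx^i$ on $M$, the horizontal and vertical lifts to $T^*M$ are $${}^HX=X^i\partial_i+p_h\Gamma^h_{ij}X^j\partial_{\bar i},\qquad {}^V\omega=\omega_i\,\partial_{\bar i}.$$ Put $g^{-1}(\omega,\theta)=g^{ij}\omega_i\theta_j$ and $\alpha=1+g^{-1}(p,p)$ at $p\in T^*M$. Let ${}^{CG}g_f$ be the $(0,2)$-tensor field on $T^*M$ that is symmetric and satisfies $${}^{CG}g_f({}^V\omega,{}^V\theta)=\tfrac1\alpha\bigl(g^{-1}(\omega,\theta)+g^{-1}(\omega,p)\,g^{-1}(\theta,p)\bigr),\quad {}^{CG}g_f({}^V\omega,{}^HY)=0,\quad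 {}^{CG}g_f({}^HX,{}^HY)=f\,g(X,Y),$$ and let $J$ be the $(1,1)$-tensor field on $T^*M$ with $J({}^HX)=-{}^HX$ and $J({}^V\omega)={}^V\omega$. Then $(T^*M,J,{}^{CG}g_f)$ is a quasi-para-Kähler–Norden manifold. That is: $J$ is an almost paracomplex structure (it is smooth, $J^2=\mathrm{id}$, $J\neq\pm\mathrm{id}$, and the eigenbundles of $J$ for $1$ and $-1$ have the same rank); ${}^{CG}g_f$ is a smooth Riemannian metric with ${}^{CG}g_f(J\tilde X,\tilde Y)={}^{CG}g_f(\tilde X,J\tilde Y)$; and, $\widetilde\nabla$ being the Levi-Civita connection of ${}^{CG}g_f$, for all smooth vector fields $\tilde X,\tilde Y,\tilde Z$ on $T^*M$ $${}^{CG}g_f\bigl((\widetilde\nabla_{\tilde X}J)\tilde Y,\tilde Z\bigr)+{}^{CG}g_f\bigl((\widetilde\nabla_{\tilde Y}J)\tilde Z,\tilde X\bigr)+{}^{CG}g_f\bigl((\widetilde\nabla_{\tilde Z}J)\tilde X,\tilde Y\bigr)=0 .$$ Moreover, with $$(\Phi_J{}^{CG}g_f)(\tilde X,\tilde Y,\tilde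 Z)=(J\tilde X)\bigl({}^{CG}g_f(\tilde Y,\tilde Z)\bigr)-\tilde X\bigl({}^{CG}g_f(J\tilde Y,\tilde Z)\bigr)+{}^{CG}g_f\bigl((L_{\tilde Y}J)\tilde X,\tilde Z\bigr)+{}^{CG}g_f\bigl(\tilde Y,(L_{\tilde Z}J)\tilde X\bigr),$$ where $L$ is the Lie derivative, for all smooth vector fields $\tilde X,\tilde Y,\tilde Z$ on $T^*M$ $$(\Phi_J{}^{CG}g_f)(\tilde X,\tilde Y,\tilde Z)+(\Phi_J{}^{CG}g_f)(\tilde Y,\tilde Z,\tilde X)+(\Phi_J{}^{CG}g_f)(\tilde Z,\tilde X,\tilde Y)=0 .$$ -/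

import Mathlib

set_option maxSynthPendingDepth 3

open Bundle Manifold
open scoped Manifold ContDiff Topology

noncomputable section

/-! ### Levi-Civita connection, Lie derivative and Tachibana operator on a manifold

Throughout, `TangentSpace I x` is Mathlib's tangent space, i.e. the model vector space `E`, a vector
being identified with its components in the preferred chart `chartAt H x` at its base point `x`. -/

namespace ManifoldTensor

section Model

variable {V W : Type*} [NormedAddCommGroup V] [NormedSpace ℝ V]
  [NormedAddCommGroup W] [NormedSpace ℝ W]

/-- The pullback `(v, w) ↦ B(Av, Aw)` of a bilinear form. -/
def pullbackForm (B : W →L[ℝ] W →L[ℝ] ℝ) (A : V →L[ℝ] W) : V →L[ℝ] V →L[ℝ] ℝ :=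
  B.bilinearComp A A

@[simp] theorem pullbackForm_apply (B : W →L[ℝ] W →L[ℝ] ℝ) (A : V →L[ℝ] W) (v w : V) :
    pullbackForm B A v w = B (A v) (A w) := rfl

/-- The square `(v, w) ↦ l(v) l(w)` of a linear form. -/
def squareForm (l : V →L[ℝ] ℝ) : V →L[ℝ] V →L[ℝ] ℝ :=
  l.smulRight l

@[simp] theorem squareForm_apply (l : V →L[ℝ] ℝ) (v w : V) : squareForm l v w = l v * l w := rfl

/-- The bilinear form `(v, w) ↦ c (B(v, w) + B(v, q) B(w, q))`. -/
def cheegerGromollForm (c : ℝ) (B : V →L[ℝ] V →L[ℝ] ℝ) (q : V) : V →L[ℝ] V →L[ℝ] ℝ :=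
  c • (B + squareForm (B.flip q))

theorem cheegerGromollForm_apply (c : ℝ) (B : V →L[ℝ] V →L[ℝ] ℝ) (q v w : V) :
    cheegerGromollForm c B q v w = c * (B v w + B v q * B w q) := rfl

/-- `v, w, u ↦ ½ (D(v; w, u) + D(w; v, u) - D(u; v, w))`. -/
def koszulForm (D : V →L[ℝ] V →L[ℝ] V →L[ℝ] ℝ) : V →L[ℝ] V →L[ℝ] V →L[ℝ] ℝ :=
  (1 / 2 : ℝ) • (D + D.flip -
    ((ContinuousLinearMap.flipₗᵢ ℝ V V ℝ).toContinuousLinearEquiv :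
      (V →L[ℝ] V →L[ℝ] ℝ) →L[ℝ] (V →L[ℝ] V →L[ℝ] ℝ)).comp D.flip)

theorem koszulForm_apply (D : V →L[ℝ] V →L[ℝ] V →L[ℝ] ℝ) (v w u : V) :
    koszulForm D v w u = (1 / 2) * (D v w u + D w v u - D u v w) := rfl

end Model

variable {E : Type*} [NormedAddCommGroup E] [NormedSpace ℝ E]
  {H : Type*} [TopologicalSpace H] (I : ModelWithCorners ℝ E H)
  (M : Type*) [TopologicalSpace M] [ChartedSpace H M]

/-- (Not necessarily smooth) tensor fields of type `(0,2)`. -/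
abbrev Tensor02 : Type _ :=
  (x : M) → TangentSpace I x →L[ℝ] TangentSpace I x →L[ℝ] ℝ

/-- (Not necessarily smooth) tensor fields of type `(1,1)`. -/
abbrev Tensor11 : Type _ :=
  (x : M) → TangentSpace I x →L[ℝ] TangentSpace I x

/-- (Not necessarily smooth) vector fields. -/
abbrev VField : Type _ :=
  (x : M) → TangentSpace I x

variable {I M}

/-- The isomorphism `g⁻¹ = ♯ : T*_x M → T_x M` inverse to `v ↦ g(v, ·)`. -/
def sharp (g : Tensor02 I M) (x : M) :
    (TangentSpace I x →L[ℝ] ℝ) →L[ℝ] TangentSpace I x :=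
  (g x).inverse

/-- The directional derivative `X_x (h)` of a real function `h` along a vector field `X`. -/
def dirDeriv (X : VField I M) (h : M → ℝ) (x : M) : ℝ :=
  mfderiv I 𝓘(ℝ, ℝ) h x (X x)

/-- The Lie derivative `(L_Y φ) X = [Y, φ X] - φ [Y, X]` of a `(1,1)`-tensor field. -/
def lieDeriv11 (Y : VField I M) (φ : Tensor11 I M) (X : VField I M) : VField I M :=
  fun x ↦ VectorField.mlieBracket I Y (fun y ↦ φ y (X y)) x
    - φ x (VectorField.mlieBracket I Y X x)

/-- The operator `Φ_φ` applied to a `(0,2)`-tensor field `g`: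
`(Φ_φ g)(X,Y,Z) = (φX)(g(Y,Z)) - X(g(φY,Z)) + g((L_Y φ)X, Z) + g(Y, (L_Z φ)X)`. -/
def PhiOp (φ : Tensor11 I M) (g : Tensor02 I M) (X Y Z : VField I M) (x : M) : ℝ :=
  dirDeriv (fun y ↦ φ y (X y)) (fun y ↦ g y (Y y) (Z y)) x
    - dirDeriv X (fun y ↦ g y (φ y (Y y)) (Z y)) x
    + g x (lieDeriv11 Y φ X x) (Z x)
    + g x (Y x) (lieDeriv11 Z φ X x)

variable [IsManifold I 1 M]

/-- The components `y ↦ (g_{ij}(y))` of `g` in the chart `chartAt H x`, as a function on `M` near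
`x` with values in bilinear forms on the model space: `(v, w) ↦ g_y(v^i ∂_i, w^j ∂_j)`. -/
def components (g : Tensor02 I M) (x : M) (y : M) : E →L[ℝ] E →L[ℝ] ℝ :=
  pullbackForm (V := E) (W := E) (g y) ((trivializationAt E (TangentSpace I) x).symmL ℝ y)

/-- The derivatives `(∂_k g_{ij})(x)` in the chart `chartAt H x`: `u, v, w ↦ u^k v^i w^j ∂_k g_ij`. -/
def dComponents (g : Tensor02 I M) (x : M) : E →L[ℝ] E →L[ℝ] E →L[ℝ] ℝ :=
  (mfderiv I 𝓘(ℝ, E →L[ℝ] E →L[ℝ] ℝ) (components g x) x : E →L[ℝ] E →L[ℝ] E →L[ℝ] ℝ)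

/-- Christoffel symbols of the first kind at `x` in the chart `chartAt H x`:
`v, w, u ↦ ½ (∂_v g(w, u) + ∂_w g(v, u) - ∂_u g(v, w))`. -/
def christoffelFirst (g : Tensor02 I M) (x : M) : E →L[ℝ] E →L[ℝ] E →L[ℝ] ℝ :=
  koszulForm (dComponents g x)

theorem christoffelFirst_apply (g : Tensor02 I M) (x : M) (v w u : E) :
    christoffelFirst g x v w u =
      (1 / 2) * (dComponents g x v w u + dComponents g x w v u - dComponents g x u v w) := rfl

/-- Christoffel symbols `v, w ↦ Γ^h_{ij} v^i w^j` at `x` in the chart `chartAt H x`. -/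
def christoffel (g : Tensor02 I M) (x : M) : E →L[ℝ] E →L[ℝ] E :=
  (ContinuousLinearMap.compL ℝ E (E →L[ℝ] ℝ) E (sharp g x)).comp (christoffelFirst g x)

theorem christoffel_apply (g : Tensor02 I M) (x : M) (v w : E) :
    christoffel g x v w = sharp g x (christoffelFirst g x v w) := rfl

/-- The Levi-Civita covariant derivative: `(∇_X Y)^h = X^i ∂_i Y^h + Γ^h_{ij} X^i Y^j`, computed at
`x` in the chart `chartAt H x`. -/
def leviCivita (g : Tensor02 I M) (X Y : VField I M) : VField I M :=
  fun x ↦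
    let D : E →L[ℝ] E :=
      mfderiv I 𝓘(ℝ, E) (fun y : M ↦ (trivializationAt E (TangentSpace I) x ⟨y, Y y⟩).2) x
    (D (X x) + christoffel g x (X x) (Y x) : E)

/-- The covariant derivative `(∇_X φ) Y = ∇_X (φ Y) - φ (∇_X Y)` of a `(1,1)`-tensor field, for the
Levi-Civita connection `∇` of `g`. -/
def covDeriv11 (g : Tensor02 I M) (φ : Tensor11 I M) (X Y : VField I M) : VField I M :=
  fun x ↦ leviCivita g X (fun y ↦ φ y (Y y)) x - φ x (leviCivita g X Y x)

/-- Smoothness of a vector field. -/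
def SmoothVField (X : VField I M) : Prop :=
  ContMDiff I (I.prod 𝓘(ℝ, E)) ∞ (fun x ↦ (TotalSpace.mk' E x (X x) : TangentBundle I M))

/-- `g` is a smooth Riemannian metric. -/
def IsRiemannianMetric (g : Tensor02 I M) : Prop :=
  ∃ G : ContMDiffRiemannianMetric I ∞ E (fun x : M ↦ TangentSpace I x), ∀ x, G.inner x = g x

/-- `φ` is an almost paracomplex structure: a smooth `(1,1)`-tensor field with `φ² = id`,
`φ ≠ ± id`, whose eigenbundles for the eigenvalues `1` and `-1` have the same rank. -/
structure IsAlmostParacomplex (φ : Tensor11 I M) : Prop where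
  smooth : ContMDiff I (I.prod 𝓘(ℝ, E →L[ℝ] E)) ∞
    (fun x ↦ TotalSpace.mk' (E →L[ℝ] E) (E := fun x : M ↦ TangentSpace I x →L[ℝ] TangentSpace I x)
      x (φ x))
  sq : ∀ (x : M) (v : TangentSpace I x), φ x (φ x v) = v
  ne_id : ∀ x : M, φ x ≠ ContinuousLinearMap.id ℝ (TangentSpace I x)
  ne_neg_id : ∀ x : M, φ x ≠ -ContinuousLinearMap.id ℝ (TangentSpace I x)
  rank_eq : ∀ x : M,
    Module.finrank ℝ (Module.End.eigenspace (φ x : TangentSpace I x →ₗ[ℝ] TangentSpace I x) 1) =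
    Module.finrank ℝ (Module.End.eigenspace (φ x : TangentSpace I x →ₗ[ℝ] TangentSpace I x) (-1))

/-- `(M, φ, g)` is an almost paracomplex Norden manifold: `φ` is an almost paracomplex structure and
`g` a Riemannian metric that is pure, `g(φX, Y) = g(X, φY)`. -/
structure IsAlmostParacomplexNorden (φ : Tensor11 I M) (g : Tensor02 I M) : Prop where
  paracomplex : IsAlmostParacomplex φ
  metric : IsRiemannianMetric g
  pure : ∀ (x : M) (v w : TangentSpace I x), g x (φ x v) w = g x v (φ x w)

/-- `(M, φ, g)` is quasi-para-Kähler–Norden: it is an almost paracomplex Norden manifold and the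
cyclic sum of `g((∇_X φ)Y, Z)` vanishes, `∇` being the Levi-Civita connection of `g`. -/
structure IsQuasiParaKahlerNorden (φ : Tensor11 I M) (g : Tensor02 I M) : Prop where
  norden : IsAlmostParacomplexNorden φ g
  cyclic : ∀ X Y Z : VField I M, SmoothVField X → SmoothVField Y → SmoothVField Z → ∀ x : M,
    g x (covDeriv11 g φ X Y x) (Z x) + g x (covDeriv11 g φ Y Z x) (X x)
      + g x (covDeriv11 g φ Z X x) (Y x) = 0

end ManifoldTensor

/-! ### The cotangent bundle -/

namespace Cotangent

open ManifoldTensor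

variable (E : Type*) [NormedAddCommGroup E] [NormedSpace ℝ E]
  (M : Type*) [TopologicalSpace M] [ChartedSpace E M] [IsManifold 𝓘(ℝ, E) ∞ M]

/-- The cotangent bundle `T*M`; its manifold structure is Mathlib's one on the total space of the
bundle of continuous linear forms on the tangent spaces. -/
abbrev CotangentBundle : Type _ :=
  TotalSpace (E →L[ℝ] ℝ) (fun x : M ↦ TangentSpace 𝓘(ℝ, E) x →L[ℝ] ℝ)

/-- The model with corners of `T*M`, with model space `E × E*`. -/
abbrev cotangentModel : ModelWithCorners ℝ (E × (E →L[ℝ] ℝ)) (ModelProd E (E →L[ℝ] ℝ)) :=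
  𝓘(ℝ, E).prod 𝓘(ℝ, E →L[ℝ] ℝ)

variable {E M}

/-- The linear form `p ∘ Γ(v, ·)`, with components `p_h Γ^h_{ij} v^j`, at `x = π(p)` in the chart
`chartAt E x`. -/
def connForm (g : Tensor02 𝓘(ℝ, E) M) (p : CotangentBundle E M) :
    E →L[ℝ] (E →L[ℝ] ℝ) :=
  (ContinuousLinearMap.compL ℝ E E ℝ (p.2 : E →L[ℝ] ℝ)).comp (christoffel g p.1)

/- The preferred chart of `T*M` at `p` consists of the coordinates `(x^i, p_i)` induced by the
preferred chart of `M` at `π(p)`; hence an element `(v, ω)` of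
`TangentSpace (cotangentModel E) p = E × E*` is the vector `v^i ∂_i + ω_i ∂_{\bar i}`. -/

/-- Vertical lift to `p` of a covector `ω` at `π(p)`: `ω_i ∂_{\bar i}`. -/
def vLift (p : CotangentBundle E M) :
    (TangentSpace 𝓘(ℝ, E) p.1 →L[ℝ] ℝ) →L[ℝ] TangentSpace (cotangentModel E) p :=
  (ContinuousLinearMap.inr ℝ E (E →L[ℝ] ℝ) : (E →L[ℝ] ℝ) →L[ℝ] E × (E →L[ℝ] ℝ))

/-- Horizontal lift to `p` of a vector `v` at `π(p)`: `v^i ∂_i + p_h Γ^h_{ij} v^j ∂_{\bar i}`. -/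
def hLift (g : Tensor02 𝓘(ℝ, E) M) (p : CotangentBundle E M) :
    TangentSpace 𝓘(ℝ, E) p.1 →L[ℝ] TangentSpace (cotangentModel E) p :=
  ((ContinuousLinearMap.id ℝ E).prod (connForm g p) : E →L[ℝ] E × (E →L[ℝ] ℝ))

/-- The vector `v` such that the horizontal part of `ξ` is `ᴴv`, i.e. the projection of `ξ`. -/
def hPart (p : CotangentBundle E M) :
    TangentSpace (cotangentModel E) p →L[ℝ] TangentSpace 𝓘(ℝ, E) p.1 :=
  (ContinuousLinearMap.fst ℝ E (E →L[ℝ] ℝ) : E × (E →L[ℝ] ℝ) →L[ℝ] E)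

/-- The covector `ω` such that the vertical part of `ξ` is `ⱽω`. -/
def vPart (g : Tensor02 𝓘(ℝ, E) M) (p : CotangentBundle E M) :
    TangentSpace (cotangentModel E) p →L[ℝ] (TangentSpace 𝓘(ℝ, E) p.1 →L[ℝ] ℝ) :=
  (ContinuousLinearMap.snd ℝ E (E →L[ℝ] ℝ)
    - (connForm g p).comp (ContinuousLinearMap.fst ℝ E (E →L[ℝ] ℝ)) :
    E × (E →L[ℝ] ℝ) →L[ℝ] (E →L[ℝ] ℝ))

theorem hLift_add_vLift (g : Tensor02 𝓘(ℝ, E) M) (p : CotangentBundle E M)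
    (ξ : TangentSpace (cotangentModel E) p) :
    hLift g p (hPart p ξ) + vLift p (vPart g p ξ) = ξ := by
  exact Prod.ext (add_zero (ξ.1 : E))
    (add_sub_cancel (connForm g p ξ.1) (ξ.2 : E →L[ℝ] ℝ))

@[simp] theorem hPart_hLift (g : Tensor02 𝓘(ℝ, E) M) (p : CotangentBundle E M)
    (v : TangentSpace 𝓘(ℝ, E) p.1) : hPart p (hLift g p v) = v := rfl

@[simp] theorem hPart_vLift (p : CotangentBundle E M) (η : TangentSpace 𝓘(ℝ, E) p.1 →L[ℝ] ℝ) :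
    hPart p (vLift p η) = 0 := rfl

@[simp] theorem vPart_hLift (g : Tensor02 𝓘(ℝ, E) M) (p : CotangentBundle E M)
    (v : TangentSpace 𝓘(ℝ, E) p.1) : vPart g p (hLift g p v) = 0 :=
  sub_self (connForm g p v : E →L[ℝ] ℝ)

@[simp] theorem vPart_vLift (g : Tensor02 𝓘(ℝ, E) M) (p : CotangentBundle E M)
    (η : TangentSpace 𝓘(ℝ, E) p.1 →L[ℝ] ℝ) : vPart g p (vLift p η) = η := by
  have h : connForm g p (0 : E) = 0 := map_zero _
  have h' : ∀ a : E →L[ℝ] ℝ, a - connForm g p 0 = a := fun a ↦ by rw [h, sub_zero]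
  exact h' η

/-- The almost paracomplex structure `J` on `T*M`, `J(ᴴX) = -ᴴX`, `J(ⱽω) = ⱽω`. -/
def J (g : Tensor02 𝓘(ℝ, E) M) : Tensor11 (cotangentModel E) (CotangentBundle E M) :=
  fun p ↦ (vLift p).comp (vPart g p) - (hLift g p).comp (hPart p)

theorem J_hLift (g : Tensor02 𝓘(ℝ, E) M) (p : CotangentBundle E M)
    (v : TangentSpace 𝓘(ℝ, E) p.1) : J g p (hLift g p v) = -hLift g p v := by
  simp [J]

theorem J_vLift (g : Tensor02 𝓘(ℝ, E) M) (p : CotangentBundle E M)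
    (η : TangentSpace 𝓘(ℝ, E) p.1 →L[ℝ] ℝ) : J g p (vLift p η) = vLift p η := by
  simp [J]

/-- The inverse metric `g⁻¹(ω, θ) = g^{ij} ω_i θ_j` on covectors at `x`. -/
def coInner (g : Tensor02 𝓘(ℝ, E) M) (x : M) :
    (TangentSpace 𝓘(ℝ, E) x →L[ℝ] ℝ) →L[ℝ] (TangentSpace 𝓘(ℝ, E) x →L[ℝ] ℝ) →L[ℝ] ℝ :=
  pullbackForm (V := E →L[ℝ] ℝ) (W := E) (g x) (sharp g x)

/-- `α = 1 + r²` with `r² = g⁻¹(p, p)`. -/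
def alpha (g : Tensor02 𝓘(ℝ, E) M) (p : CotangentBundle E M) : ℝ :=
  1 + coInner g p.1 p.2 p.2

/-- The inner product `(ω, θ) ↦ (g⁻¹(ω,θ) + g⁻¹(ω,p) g⁻¹(θ,p)) / α` on covectors at `π(p)`. -/
def vertMetric (g : Tensor02 𝓘(ℝ, E) M) (p : CotangentBundle E M) :
    (TangentSpace 𝓘(ℝ, E) p.1 →L[ℝ] ℝ) →L[ℝ] (TangentSpace 𝓘(ℝ, E) p.1 →L[ℝ] ℝ) →L[ℝ] ℝ :=
  cheegerGromollForm (V := E →L[ℝ] ℝ) (1 / alpha g p) (coInner g p.1) p.2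

/-- The rescaled metric of Cheeger–Gromoll type on `T*M`, characterized by
`cgMetric_vLift_vLift`, `cgMetric_vLift_hLift`, `cgMetric_hLift_hLift`. -/
def cgMetric (g : Tensor02 𝓘(ℝ, E) M) (f : M → ℝ) :
    Tensor02 (cotangentModel E) (CotangentBundle E M) :=
  fun p ↦
    f p.1 • pullbackForm (V := E × (E →L[ℝ] ℝ)) (W := E) (g p.1) (hPart p)
      + pullbackForm (V := E × (E →L[ℝ] ℝ)) (W := E →L[ℝ] ℝ) (vertMetric g p) (vPart g p)

theorem cgMetric_apply (g : Tensor02 𝓘(ℝ, E) M) (f : M → ℝ) (p : CotangentBundle E M)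
    (ξ ζ : TangentSpace (cotangentModel E) p) :
    cgMetric g f p ξ ζ = f p.1 * g p.1 (hPart p ξ) (hPart p ζ)
      + vertMetric g p (vPart g p ξ) (vPart g p ζ) := rfl

theorem cgMetric_vLift_vLift (g : Tensor02 𝓘(ℝ, E) M) (f : M → ℝ) (p : CotangentBundle E M)
    (η θ : TangentSpace 𝓘(ℝ, E) p.1 →L[ℝ] ℝ) :
    cgMetric g f p (vLift p η) (vLift p θ) = 1 / alpha g p *
      (coInner g p.1 η θ + coInner g p.1 η p.2 * coInner g p.1 θ p.2) := by
  rw [cgMetric_apply, hPart_vLift, hPart_vLift, vPart_vLift, vPart_vLift]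
  simp only [map_zero, mul_zero, zero_add]
  rfl

theorem cgMetric_vLift_hLift (g : Tensor02 𝓘(ℝ, E) M) (f : M → ℝ) (p : CotangentBundle E M)
    (η : TangentSpace 𝓘(ℝ, E) p.1 →L[ℝ] ℝ) (v : TangentSpace 𝓘(ℝ, E) p.1) :
    cgMetric g f p (vLift p η) (hLift g p v) = 0 := by
  simp [cgMetric_apply]

theorem cgMetric_hLift_hLift (g : Tensor02 𝓘(ℝ, E) M) (f : M → ℝ) (p : CotangentBundle E M)
    (v w : TangentSpace 𝓘(ℝ, E) p.1) :
    cgMetric g f p (hLift g p v) (hLift g p w) = f p.1 * g p.1 v w := by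
  simp [cgMetric_apply]

end Cotangent

end

/-! Both cyclic identities reduce to one pointwise identity. In a chart, let G and J denote the
components of the metric and of the paracomplex structure. Symmetry of G and the derivative of the
purity identity turn the cyclic sum of G((∇_x J)y, z) into that of `phiTerm`, namely (D_{Jx}G)(y,z)
- (D_xG)(Jy,z) + G((D_xJ)z, y). In the cyclic sum of Φ_J G most derivatives of J cancel and the same
expression is left. These are `cyclic_covDeriv_eq_phiTerm` and `cyclic_phi_eq_phiTerm`; it remains
to prove `cyclic_phiTerm_model`.

On T*M, in induced coordinates, put N(v) = p ∘ Γ(v, ·) and let V be the fibre metric. A vector ξ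
satisfies Jξ = ξ - 2 hor(ξ) = 2 ver(ξ) - ξ. Hence D_{Jξ} - D_ξ differentiates V only horizontally,
and D_{Jξ} + D_ξ differentiates N only vertically. Along a horizontal direction both g⁻¹ and p are
parallel, so V changes only through Γ (`fderiv_modelVert_horizontal`); N is linear in p, so its
vertical derivative is Γ again (`fderiv_modelConn_inr`). The derivatives of f g cancel because J is
-1 on horizontal vectors, and the derivatives of N along ξ cancel too, so no curvature enters. What
is left is a combination of terms V(a ∘ Γ(b, ·), c), which cancel in pairs in the cyclic sum by the
symmetry of V.

The coordinate formulas must hold on a neighbourhood, whereas J and the metric are defined at each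
point through the chart preferred there. The bridge is `modelVPart_tangentCoordChange`: the second
derivative of the transition map occurs in the Jacobian of the cotangent charts and in the
transformation law of Γ, and the two occurrences cancel. The resulting formulas `coord11_J` and
`coord02_cgMetric` also give smoothness. -/

noncomputable section

namespace ManifoldTensor

/-! ### Algebra of the two cyclic sums at a point -/

section Pointwise

variable {V : Type*} [NormedAddCommGroup V] [NormedSpace ℝ V]

/-- The coordinate expression at a point of the summand
`(D_{Jx} G)(y, z) - (D_x G)(Jy, z) + G((D_x J) z, y)` whose cyclic sum computes both the cyclic sum
of `G((∇_x J) y, z)` and the one of `Φ_J G`. -/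
def phiTerm (G : V →L[ℝ] V →L[ℝ] ℝ) (J : V →L[ℝ] V) (dG : V →L[ℝ] V →L[ℝ] V →L[ℝ] ℝ)
    (dJ : V →L[ℝ] V →L[ℝ] V) (x y z : V) : ℝ :=
  dG (J x) y z - dG x (J y) z + G (dJ x z) y

/-- Here `koszulForm dG` is the lowered Christoffel symbol, with J moved to the last slot by purity.
Summed cyclically, the Koszul terms leave only D_{Jx}G(y,z) - D_xG(y,Jz); the differentiated purity
`hdJ` then trades D_xG(y,Jz) for D_xG(Jy,z), exchanging the two derivatives of J. -/
theorem cyclic_covDeriv_eq_phiTerm {G : V →L[ℝ] V →L[ℝ] ℝ} {J : V →L[ℝ] V}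
    {dG : V →L[ℝ] V →L[ℝ] V →L[ℝ] ℝ} {dJ : V →L[ℝ] V →L[ℝ] V}
    (hG : ∀ v w, G v w = G w v) (hdG : ∀ u v w, dG u v w = dG u w v)
    (hdJ : ∀ u v w, dG u (J v) w + G (dJ u v) w = dG u v (J w) + G v (dJ u w)) (x y z : V) :
    (G (dJ x y) z + koszulForm dG x (J y) z - koszulForm dG x y (J z)) +
      (G (dJ y z) x + koszulForm dG y (J z) x - koszulForm dG y z (J x)) +
      (G (dJ z x) y + koszulForm dG z (J x) y - koszulForm dG z x (J y)) =
    phiTerm G J dG dJ x y z + phiTerm G J dG dJ y z x + phiTerm G J dG dJ z x y := by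
  simp only [koszulForm_apply, phiTerm]
  have h1 := hdJ x y z
  have h2 := hdJ y z x
  have h3 := hdJ z x y
  rw [hG y] at h1
  rw [hG z] at h2
  rw [hG x] at h3
  rw [hdG x y (J z)] at h1 ⊢
  rw [hdG y z (J x)] at h2 ⊢
  rw [hdG z x (J y)] at h3 ⊢
  rw [hdG (J x) z y, hdG (J y) x z, hdG (J z) y x, hdG x z (J y), hdG y x (J z),
    hdG z y (J x)]
  linarith

/-- Each negative term G(dJ x y) z meets the term G z (dJ x y) of the next summand, so one
derivative of J per summand survives. -/
theorem cyclic_phi_eq_phiTerm {G : V →L[ℝ] V →L[ℝ] ℝ} {J : V →L[ℝ] V}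
    {dG : V →L[ℝ] V →L[ℝ] V →L[ℝ] ℝ} {dJ : V →L[ℝ] V →L[ℝ] V}
    (hG : ∀ v w, G v w = G w v) (x y z : V) :
    (dG (J x) y z - dG x (J y) z - G (dJ x y) z + G (dJ y x) z + G y (dJ z x)) +
      (dG (J y) z x - dG y (J z) x - G (dJ y z) x + G (dJ z y) x + G z (dJ x y)) +
      (dG (J z) x y - dG z (J x) y - G (dJ z x) y + G (dJ x z) y + G x (dJ y z)) =
    phiTerm G J dG dJ x y z + phiTerm G J dG dJ y z x + phiTerm G J dG dJ z x y := by
  simp only [phiTerm]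
  rw [hG y, hG z, hG x]
  ring

/-- Product rule on both sides of the purity identity; it supplies the hypothesis `hdJ` above. -/
theorem pure_fderiv {G : V → V →L[ℝ] V →L[ℝ] ℝ} {J : V → V →L[ℝ] V} {z : V}
    (hG : DifferentiableAt ℝ G z) (hJ : DifferentiableAt ℝ J z)
    (h : ∀ᶠ y in 𝓝 z, ∀ v w, G y (J y v) w = G y v (J y w)) (u v w : V) :
    fderiv ℝ G z u (J z v) w + G z (fderiv ℝ J z u v) w =
      fderiv ℝ G z u v (J z w) + G z v (fderiv ℝ J z u w) := by
  have h1 : HasFDerivAt (fun y ↦ G y (J y v) w) _ z :=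
    (hG.hasFDerivAt.clm_apply (hJ.hasFDerivAt.clm_apply (hasFDerivAt_const v z))).clm_apply
      (hasFDerivAt_const w z)
  have h2 : HasFDerivAt (fun y ↦ G y v (J y w)) _ z :=
    (hG.hasFDerivAt.clm_apply (hasFDerivAt_const v z)).clm_apply
      (hJ.hasFDerivAt.clm_apply (hasFDerivAt_const w z))
  have h3 := h1.congr_of_eventuallyEq
    (f₁ := fun y ↦ G y v (J y w)) (h.mono fun y hy ↦ (hy v w).symm)
  have := congrArg (fun l : V →L[ℝ] ℝ ↦ l u) (h3.unique h2)
  simp at this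
  linarith

theorem symm_fderiv {G : V → V →L[ℝ] V →L[ℝ] ℝ} {z : V}
    (hG : DifferentiableAt ℝ G z)
    (h : ∀ᶠ y in 𝓝 z, ∀ v w, G y v w = G y w v) (u v w : V) :
    fderiv ℝ G z u v w = fderiv ℝ G z u w v := by
  have h1 (v w : V) : HasFDerivAt (fun y ↦ G y v w) _ z :=
    (hG.hasFDerivAt.clm_apply (hasFDerivAt_const v z)).clm_apply (hasFDerivAt_const w z)
  have h3 := (h1 v w).congr_of_eventuallyEq
    (f₁ := fun y ↦ G y w v) (h.mono fun y hy ↦ (hy v w).symm)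
  have := congrArg (fun l : V →L[ℝ] ℝ ↦ l u) (h3.unique (h1 w v))
  simpa using this

end Pointwise

/-! ### Christoffel symbols and the inverse metric on an open set of a vector space -/

section Christoffel

variable {E : Type*} [NormedAddCommGroup E] [NormedSpace ℝ E]

/-- Christoffel symbols at `u` of a metric `G` on an open set of a vector space. -/
def modelChristoffel (G : E → E →L[ℝ] E →L[ℝ] ℝ) (u : E) : E →L[ℝ] E →L[ℝ] E :=
  (ContinuousLinearMap.compL ℝ E (E →L[ℝ] ℝ) E (G u).inverse).comp (koszulForm (fderiv ℝ G u))

theorem apply_inverse_of_isInvertible {F : Type*} [NormedAddCommGroup F] [NormedSpace ℝ F]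
    {A : E →L[ℝ] F} (hA : A.IsInvertible) (l : F) :
    A (A.inverse l) = l := by
  obtain ⟨e, rfl⟩ := hA
  simp

theorem inverse_apply_of_isInvertible {F : Type*} [NormedAddCommGroup F] [NormedSpace ℝ F]
    {A : E →L[ℝ] F} (hA : A.IsInvertible) (v : E) :
    A.inverse (A v) = v := by
  obtain ⟨e, rfl⟩ := hA
  simp

theorem metric_modelChristoffel {G : E → E →L[ℝ] E →L[ℝ] ℝ} {u : E} (hG : (G u).IsInvertible)
    (v w x : E) : G u (modelChristoffel G u v w) x = koszulForm (fderiv ℝ G u) v w x := by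
  have := apply_inverse_of_isInvertible hG (koszulForm (fderiv ℝ G u) v w)
  exact congrArg (fun l : E →L[ℝ] ℝ ↦ l x) this

/-- Metric compatibility, ∇G = 0: two Koszul expressions with the last two arguments exchanged add
up to a single derivative of G. -/
theorem fderiv_metric {G : E → E →L[ℝ] E →L[ℝ] ℝ} {u : E} (hG : (G u).IsInvertible)
    (hd : DifferentiableAt ℝ G u) (hs : ∀ᶠ y in 𝓝 u, ∀ v w, G y v w = G y w v) (v a b : E) :
    fderiv ℝ G u v a b =
      G u (modelChristoffel G u v a) b + G u a (modelChristoffel G u v b) := by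
  rw [hs.self_of_nhds a, metric_modelChristoffel hG, metric_modelChristoffel hG]
  simp only [koszulForm_apply]
  rw [symm_fderiv hd hs v b a]
  ring

theorem contDiffAt_inverse_metric [CompleteSpace E] {G : E → E →L[ℝ] E →L[ℝ] ℝ} {u : E}
    (hG : (G u).IsInvertible) {n : ℕ∞ω} (hd : ContDiffAt ℝ n G u) :
    ContDiffAt ℝ n (fun y ↦ (G y).inverse) u := by
  obtain ⟨e, he⟩ := hG
  exact ContDiffAt.comp u (he ▸ contDiffAt_map_inverse e) hd

/-- `koszulForm` as a continuous linear map. -/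
def koszulFormL (V : Type*) [NormedAddCommGroup V] [NormedSpace ℝ V] :
    (V →L[ℝ] V →L[ℝ] V →L[ℝ] ℝ) →L[ℝ] (V →L[ℝ] V →L[ℝ] V →L[ℝ] ℝ) :=
  (1 / 2 : ℝ) • (ContinuousLinearMap.id ℝ _ +
    ((ContinuousLinearMap.flipₗᵢ ℝ V V (V →L[ℝ] ℝ)).toContinuousLinearEquiv :
      (V →L[ℝ] V →L[ℝ] V →L[ℝ] ℝ) →L[ℝ] (V →L[ℝ] V →L[ℝ] V →L[ℝ] ℝ)) -
    (ContinuousLinearMap.compL ℝ V (V →L[ℝ] V →L[ℝ] ℝ) (V →L[ℝ] V →L[ℝ] ℝ)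
      ((ContinuousLinearMap.flipₗᵢ ℝ V V ℝ).toContinuousLinearEquiv :
      (V →L[ℝ] V →L[ℝ] ℝ) →L[ℝ] (V →L[ℝ] V →L[ℝ] ℝ))).comp
    ((ContinuousLinearMap.flipₗᵢ ℝ V V (V →L[ℝ] ℝ)).toContinuousLinearEquiv :
      (V →L[ℝ] V →L[ℝ] V →L[ℝ] ℝ) →L[ℝ] (V →L[ℝ] V →L[ℝ] V →L[ℝ] ℝ)))

/-- Inversion of operators is smooth at invertible ones, and the Koszul combination is a fixed
continuous linear map, `koszulFormL`, applied to the derivative of G. -/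
theorem contDiffAt_modelChristoffel [CompleteSpace E] {G : E → E →L[ℝ] E →L[ℝ] ℝ} {u : E}
    (hG : (G u).IsInvertible) (hd : ContDiffAt ℝ ∞ G u) :
    ContDiffAt ℝ ∞ (modelChristoffel G) u := by
  have h1 : ContDiffAt ℝ ∞ (fun y ↦ koszulFormL E (fderiv ℝ G y)) u :=
    (koszulFormL E).contDiff.contDiffAt.comp u (hd.fderiv_right (m := ∞) (by simp))
  have h2 := contDiffAt_inverse_metric hG hd
  exact ((ContinuousLinearMap.compL ℝ E (E →L[ℝ] ℝ) E).contDiff.contDiffAt.comp u h2).clm_comp h1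

/-- The inverse metric in coordinates. -/
def modelCoInner (G : E → E →L[ℝ] E →L[ℝ] ℝ) (u : E) : (E →L[ℝ] ℝ) →L[ℝ] (E →L[ℝ] ℝ) →L[ℝ] ℝ :=
  pullbackForm (G u) (G u).inverse

theorem modelCoInner_apply {G : E → E →L[ℝ] E →L[ℝ] ℝ} {u : E}
    (hG : (G u).IsInvertible) (a b : E →L[ℝ] ℝ) :
    modelCoInner G u a b = a ((G u).inverse b) := by
  rw [modelCoInner, pullbackForm_apply, apply_inverse_of_isInvertible hG]

theorem contDiffAt_pullbackForm {U V W : Type*} [NormedAddCommGroup U] [NormedSpace ℝ U]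
    [NormedAddCommGroup V] [NormedSpace ℝ V] [NormedAddCommGroup W] [NormedSpace ℝ W]
    {n : ℕ∞ω} {B : U → W →L[ℝ] W →L[ℝ] ℝ} {A : U → V →L[ℝ] W} {u : U}
    (hB : ContDiffAt ℝ n B u) (hA : ContDiffAt ℝ n A u) :
    ContDiffAt ℝ n (fun y ↦ pullbackForm (B y) (A y)) u := by
  have h1 : ContDiffAt ℝ n (fun y ↦ (B y).comp (A y)) u := hB.clm_comp hA
  have h2 : ContDiffAt ℝ n (fun y ↦ ((ContinuousLinearMap.compL ℝ V W ℝ).flip (A y)).comp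
      ((B y).comp (A y))) u :=
    ((ContinuousLinearMap.compL ℝ V W ℝ).flip.contDiff.contDiffAt.comp u hA).clm_comp h1
  exact h2

theorem contDiffAt_modelCoInner [CompleteSpace E] {G : E → E →L[ℝ] E →L[ℝ] ℝ} {u : E}
    (hG : (G u).IsInvertible) {n : ℕ∞ω} (hd : ContDiffAt ℝ n G u) :
    ContDiffAt ℝ n (modelCoInner G) u :=
  contDiffAt_pullbackForm hd (contDiffAt_inverse_metric hG hd)

theorem eventually_isInvertible [CompleteSpace E] {G : E → E →L[ℝ] E →L[ℝ] ℝ} {u : E}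
    (hG : (G u).IsInvertible) (hc : ContinuousAt G u) : ∀ᶠ y in 𝓝 u, (G y).IsInvertible := by
  obtain ⟨e, he⟩ := hG
  exact hc (he ▸ ContinuousLinearEquiv.nhds e)

/-- The inverse metric is parallel. This follows from ∇G = 0 by differentiating G(G⁻¹b) = b. -/
theorem fderiv_modelCoInner [CompleteSpace E] {G : E → E →L[ℝ] E →L[ℝ] ℝ} {u : E}
    (hG : (G u).IsInvertible)
    (hd : ContDiffAt ℝ 1 G u) (hs : ∀ᶠ y in 𝓝 u, ∀ v w, G y v w = G y w v) (v : E)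
    (a b : E →L[ℝ] ℝ) :
    fderiv ℝ (modelCoInner G) u v a b =
      - modelCoInner G u (a.comp (modelChristoffel G u v)) b
      - modelCoInner G u a (b.comp (modelChristoffel G u v)) := by
  have hd' := hd.differentiableAt one_ne_zero
  have hI := (contDiffAt_inverse_metric hG hd).differentiableAt one_ne_zero
  have hC := (contDiffAt_modelCoInner hG hd).differentiableAt one_ne_zero
  have hev := eventually_isInvertible hG hd.continuousAt
  -- The derivative D of G⁻¹b is never computed: only its pairing with a is needed, and testing the
  -- differentiated identity against G⁻¹a yields exactly that.
  set D := fderiv ℝ (fun y ↦ (G y).inverse) u v b with hD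
  have h1 : HasFDerivAt (fun y ↦ G y ((G y).inverse b)) _ u :=
    hd'.hasFDerivAt.clm_apply (hI.hasFDerivAt.clm_apply (hasFDerivAt_const b u))
  have h1' := h1.congr_of_eventuallyEq (f₁ := fun _ ↦ b)
    (hev.mono fun y hy ↦ (apply_inverse_of_isInvertible hy b).symm)
  have e1 := congrArg (fun l : E →L[ℝ] E →L[ℝ] ℝ ↦ l v ((G u).inverse a))
    (h1'.unique (hasFDerivAt_const b u))
  have h2 : HasFDerivAt (fun y ↦ modelCoInner G y a b) _ u :=
    (hC.hasFDerivAt.clm_apply (hasFDerivAt_const a u)).clm_apply (hasFDerivAt_const b u)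
  have h3 : HasFDerivAt (fun y ↦ a ((G y).inverse b)) _ u :=
    a.hasFDerivAt.comp u (hI.hasFDerivAt.clm_apply (hasFDerivAt_const b u))
  have h3' := h3.congr_of_eventuallyEq (f₁ := fun y ↦ modelCoInner G y a b)
    (hev.mono fun y hy ↦ modelCoInner_apply hy a b)
  have e2 := congrArg (fun l : E →L[ℝ] ℝ ↦ l v) (h2.unique h3')
  simp at e1 e2
  rw [e2]
  rw [← hD] at e1 ⊢
  rw [fderiv_metric hG hd' hs, hs.self_of_nhds D, apply_inverse_of_isInvertible hG,
    apply_inverse_of_isInvertible hG, hs.self_of_nhds _ ((G u).inverse a),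
    apply_inverse_of_isInvertible hG] at e1
  rw [modelCoInner_apply hG, modelCoInner, pullbackForm_apply, hs.self_of_nhds _ _,
    apply_inverse_of_isInvertible hG]
  simp only [ContinuousLinearMap.comp_apply]
  linarith

end Christoffel

end ManifoldTensor

set_option synthInstance.maxHeartbeats 200000
namespace Cotangent

open ManifoldTensor

/-! ### The cotangent bundle in induced coordinates: formulas, smoothness, derivatives -/

section ModelCotangent

variable {E : Type*} [NormedAddCommGroup E] [NormedSpace ℝ E]

/-- The linear form `q ∘ Γ(v, ·)` in coordinates. -/
def modelConn (g : E → E →L[ℝ] E →L[ℝ] ℝ) (z : E × (E →L[ℝ] ℝ)) : E →L[ℝ] (E →L[ℝ] ℝ) :=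
  (ContinuousLinearMap.compL ℝ E E ℝ z.2).comp (modelChristoffel g z.1)

/-- The vertical part in coordinates. -/
def modelVPart (g : E → E →L[ℝ] E →L[ℝ] ℝ) (z : E × (E →L[ℝ] ℝ)) :
    E × (E →L[ℝ] ℝ) →L[ℝ] (E →L[ℝ] ℝ) :=
  ContinuousLinearMap.snd ℝ E (E →L[ℝ] ℝ)
    - (modelConn g z).comp (ContinuousLinearMap.fst ℝ E (E →L[ℝ] ℝ))

/-- The almost paracomplex structure of the cotangent bundle in coordinates. -/
def modelJ (g : E → E →L[ℝ] E →L[ℝ] ℝ) (z : E × (E →L[ℝ] ℝ)) :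
    E × (E →L[ℝ] ℝ) →L[ℝ] E × (E →L[ℝ] ℝ) :=
  (ContinuousLinearMap.inr ℝ E (E →L[ℝ] ℝ)).comp (modelVPart g z) -
    ((ContinuousLinearMap.id ℝ E).prod (modelConn g z)).comp
      (ContinuousLinearMap.fst ℝ E (E →L[ℝ] ℝ))

/-- The metric on the vertical spaces in coordinates. -/
def modelVert (g : E → E →L[ℝ] E →L[ℝ] ℝ) (z : E × (E →L[ℝ] ℝ)) :
    (E →L[ℝ] ℝ) →L[ℝ] (E →L[ℝ] ℝ) →L[ℝ] ℝ :=
  cheegerGromollForm (1 / (1 + modelCoInner g z.1 z.2 z.2)) (modelCoInner g z.1) z.2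

/-- The rescaled metric of Cheeger-Gromoll type in coordinates. -/
def modelMetric (g : E → E →L[ℝ] E →L[ℝ] ℝ) (f : E → ℝ) (z : E × (E →L[ℝ] ℝ)) :
    E × (E →L[ℝ] ℝ) →L[ℝ] E × (E →L[ℝ] ℝ) →L[ℝ] ℝ :=
  f z.1 • pullbackForm (g z.1) (ContinuousLinearMap.fst ℝ E (E →L[ℝ] ℝ)) +
    pullbackForm (modelVert g z) (modelVPart g z)

theorem modelVPart_apply (g : E → E →L[ℝ] E →L[ℝ] ℝ) (z ξ : E × (E →L[ℝ] ℝ)) :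
    modelVPart g z ξ = ξ.2 - modelConn g z ξ.1 := rfl

theorem modelJ_apply (g : E → E →L[ℝ] E →L[ℝ] ℝ) (z ξ : E × (E →L[ℝ] ℝ)) :
    modelJ g z ξ = (-ξ.1, ξ.2 - modelConn g z ξ.1 - modelConn g z ξ.1) := by
  ext : 1
  · simp [modelJ]
  · simp [modelJ, modelVPart]

theorem modelVPart_modelJ (g : E → E →L[ℝ] E →L[ℝ] ℝ) (z ξ : E × (E →L[ℝ] ℝ)) :
    modelVPart g z (modelJ g z ξ) = modelVPart g z ξ := by
  simp [modelVPart_apply, modelJ_apply]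

theorem modelMetric_apply (g : E → E →L[ℝ] E →L[ℝ] ℝ) (f : E → ℝ) (z ξ ζ : E × (E →L[ℝ] ℝ)) :
    modelMetric g f z ξ ζ = f z.1 * g z.1 ξ.1 ζ.1 +
      modelVert g z (modelVPart g z ξ) (modelVPart g z ζ) := rfl

theorem modelVert_apply (g : E → E →L[ℝ] E →L[ℝ] ℝ) (z : E × (E →L[ℝ] ℝ)) (a b : E →L[ℝ] ℝ) :
    modelVert g z a b = 1 / (1 + modelCoInner g z.1 z.2 z.2) * (modelCoInner g z.1 a b +
      modelCoInner g z.1 a z.2 * modelCoInner g z.1 b z.2) := rfl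

section Smooth

variable [CompleteSpace E] {g : E → E →L[ℝ] E →L[ℝ] ℝ} {f : E → ℝ} {z : E × (E →L[ℝ] ℝ)}

theorem contDiffAt_modelConn (hg : (g z.1).IsInvertible) (hd : ContDiffAt ℝ ∞ g z.1) :
    ContDiffAt ℝ ∞ (modelConn g) z :=
  ((ContinuousLinearMap.compL ℝ E E ℝ).contDiff.contDiffAt.comp z contDiffAt_snd).clm_comp
    ((contDiffAt_modelChristoffel hg hd).comp z contDiffAt_fst)

theorem contDiffAt_modelVPart (hg : (g z.1).IsInvertible) (hd : ContDiffAt ℝ ∞ g z.1) :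
    ContDiffAt ℝ ∞ (modelVPart g) z :=
  contDiffAt_const.sub ((contDiffAt_modelConn hg hd).clm_comp contDiffAt_const)

theorem contDiffAt_modelJ (hg : (g z.1).IsInvertible) (hd : ContDiffAt ℝ ∞ g z.1) :
    ContDiffAt ℝ ∞ (modelJ g) z := by
  -- The pairing of `id` with N is rewritten as a sum of compositions with the two injections, to
  -- which the smoothness rules for sums and compositions apply.
  have h : modelJ g = fun z ↦
      (ContinuousLinearMap.inr ℝ E (E →L[ℝ] ℝ)).comp (modelVPart g z) -
      ((ContinuousLinearMap.inl ℝ E (E →L[ℝ] ℝ)) +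
        (ContinuousLinearMap.inr ℝ E (E →L[ℝ] ℝ)).comp (modelConn g z)).comp
        (ContinuousLinearMap.fst ℝ E (E →L[ℝ] ℝ)) := by
    funext z
    ext ξ : 2 <;> simp [modelJ]
  rw [h]
  exact (contDiffAt_const.clm_comp (contDiffAt_modelVPart hg hd)).sub
    ((contDiffAt_const.add (contDiffAt_const.clm_comp (contDiffAt_modelConn hg hd))).clm_comp
      contDiffAt_const)

theorem contDiffAt_modelVert (hg : (g z.1).IsInvertible) (hd : ContDiffAt ℝ ∞ g z.1)
    (hz : 1 + modelCoInner g z.1 z.2 z.2 ≠ 0) : ContDiffAt ℝ ∞ (modelVert g) z := by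
  have hB : ContDiffAt ℝ ∞ (fun y : E × (E →L[ℝ] ℝ) ↦ modelCoInner g y.1) z :=
    (contDiffAt_modelCoInner hg hd).comp z contDiffAt_fst
  have hl : ContDiffAt ℝ ∞ (fun y : E × (E →L[ℝ] ℝ) ↦ (modelCoInner g y.1).flip y.2) z :=
    ((ContinuousLinearMap.flipₗᵢ ℝ (E →L[ℝ] ℝ) (E →L[ℝ] ℝ) ℝ).contDiff.contDiffAt.comp z
      hB).clm_apply contDiffAt_snd
  have hsq : ContDiffAt ℝ ∞ (fun y : E × (E →L[ℝ] ℝ) ↦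
      squareForm ((modelCoInner g y.1).flip y.2)) z :=
    hl.smulRight hl
  have hc : ContDiffAt ℝ ∞ (fun y : E × (E →L[ℝ] ℝ) ↦ 1 / (1 + modelCoInner g y.1 y.2 y.2)) z :=
    contDiffAt_const.div (contDiffAt_const.add
      ((hB.clm_apply contDiffAt_snd).clm_apply contDiffAt_snd)) hz
  exact hc.smul (hB.add hsq)

theorem contDiffAt_modelMetric (hg : (g z.1).IsInvertible) (hd : ContDiffAt ℝ ∞ g z.1)
    (hz : 1 + modelCoInner g z.1 z.2 z.2 ≠ 0) (hf : ContDiffAt ℝ ∞ f z.1) :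
    ContDiffAt ℝ ∞ (modelMetric g f) z :=
  ((hf.comp z contDiffAt_fst).smul
    (contDiffAt_pullbackForm (hd.comp z contDiffAt_fst) contDiffAt_const)).add
    (contDiffAt_pullbackForm (contDiffAt_modelVert hg hd hz) (contDiffAt_modelVPart hg hd))

end Smooth

section Derivatives

variable [CompleteSpace E] {g : E → E →L[ℝ] E →L[ℝ] ℝ} {f : E → ℝ} {z : E × (E →L[ℝ] ℝ)}

/-- N is linear in the covector variable, and Γ does not depend on it. -/
theorem fderiv_modelConn_inr (hg : (g z.1).IsInvertible) (hd : ContDiffAt ℝ ∞ g z.1)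
    (a : E →L[ℝ] ℝ) (v : E) :
    fderiv ℝ (modelConn g) z (0, a) v = a.comp (modelChristoffel g z.1 v) := by
  have h1 := ((contDiffAt_modelChristoffel hg hd).differentiableAt (by simp)).hasFDerivAt
  have h2 : HasFDerivAt (modelConn g) _ z :=
    ((ContinuousLinearMap.compL ℝ E E ℝ).hasFDerivAt.comp z hasFDerivAt_snd).clm_comp
      (h1.comp z hasFDerivAt_fst)
  rw [h2.fderiv]
  ext w
  simp

theorem fderiv_modelJ (hg : (g z.1).IsInvertible) (hd : ContDiffAt ℝ ∞ g z.1)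
    (ξ η : E × (E →L[ℝ] ℝ)) :
    fderiv ℝ (modelJ g) z ξ η = (0, - (2 : ℝ) • fderiv ℝ (modelConn g) z ξ η.1) := by
  have h1 := ((contDiffAt_modelConn hg hd).differentiableAt (by simp)).hasFDerivAt.clm_apply
    (hasFDerivAt_const η.1 z)
  have h2 : HasFDerivAt (fun y ↦ modelJ g y η) _ z :=
    ((contDiffAt_modelJ hg hd).differentiableAt (by simp)).hasFDerivAt.clm_apply
    (hasFDerivAt_const η z)
  have h3 : HasFDerivAt (fun y ↦ ((-η.1, η.2 - modelConn g y η.1 - modelConn g y η.1) :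
      E × (E →L[ℝ] ℝ))) _ z :=
    (hasFDerivAt_const (-η.1) z).prodMk (((hasFDerivAt_const η.2 z).sub h1).sub h1)
  have h4 := h3.congr_of_eventuallyEq (f₁ := fun y ↦ modelJ g y η)
    (Filter.Eventually.of_forall fun y ↦ modelJ_apply g y η)
  have := congrArg (fun l : E × (E →L[ℝ] ℝ) →L[ℝ] E × (E →L[ℝ] ℝ) ↦ l ξ) (h2.unique h4)
  simp at this
  rw [this]
  ext : 1
  · rfl
  · simp only [neg_smul, two_smul, neg_add]
    abel

/-- Product rule with constant η and ζ. The vertical part depends on the point only through N, which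
accounts for the last two terms. -/
theorem fderiv_modelMetric (hg : (g z.1).IsInvertible) (hd : ContDiffAt ℝ ∞ g z.1)
    (hz : 1 + modelCoInner g z.1 z.2 z.2 ≠ 0) (hf : ContDiffAt ℝ ∞ f z.1)
    (ξ η ζ : E × (E →L[ℝ] ℝ)) :
    fderiv ℝ (modelMetric g f) z ξ η ζ = fderiv ℝ (fun u ↦ f u • g u) z.1 ξ.1 η.1 ζ.1 +
      fderiv ℝ (modelVert g) z ξ (modelVPart g z η) (modelVPart g z ζ) -
      modelVert g z (fderiv ℝ (modelConn g) z ξ η.1) (modelVPart g z ζ) -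
      modelVert g z (modelVPart g z η) (fderiv ℝ (modelConn g) z ξ ζ.1) := by
  have hN := ((contDiffAt_modelConn hg hd).differentiableAt (by simp)).hasFDerivAt
  have hV := ((contDiffAt_modelVert hg hd hz).differentiableAt (by simp)).hasFDerivAt
  have hK : HasFDerivAt (fun u ↦ f u • g u) (fderiv ℝ (fun u ↦ f u • g u) z.1) z.1 :=
    ((hf.smul hd).differentiableAt (by simp)).hasFDerivAt
  have hP (η : E × (E →L[ℝ] ℝ)) : HasFDerivAt (fun y ↦ modelVPart g y η) _ z :=
    (hasFDerivAt_const η.2 z).sub (hN.clm_apply (hasFDerivAt_const η.1 z))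
  have h1 : HasFDerivAt (fun y : E × (E →L[ℝ] ℝ) ↦ (f y.1 • g y.1) η.1 ζ.1) _ z :=
    ((hK.comp z hasFDerivAt_fst).clm_apply (hasFDerivAt_const η.1 z)).clm_apply
      (hasFDerivAt_const ζ.1 z)
  have h2 : HasFDerivAt (fun y ↦ modelMetric g f y η ζ) _ z :=
    h1.add ((hV.clm_apply (hP η)).clm_apply (hP ζ))
  have h3 : HasFDerivAt (fun y ↦ modelMetric g f y η ζ) _ z :=
    (((contDiffAt_modelMetric hg hd hz hf).differentiableAt (by simp)).hasFDerivAt.clm_apply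
    (hasFDerivAt_const η z)).clm_apply (hasFDerivAt_const ζ z)
  have := congrArg (fun l : E × (E →L[ℝ] ℝ) →L[ℝ] ℝ ↦ l ξ) (h3.unique h2)
  simp at this
  rw [this]
  ring

/-- Moving along (v, N(v)) transports p parallelly, and g⁻¹ is parallel. Thus g⁻¹(p,p) is constant
to first order, and in g⁻¹(a,b) and g⁻¹(a,p) only the constant covectors a and b contribute Γ terms.
The particular weight 1/α plays no role beyond being a function of g⁻¹(p,p). -/
theorem fderiv_modelVert_horizontal (hg : (g z.1).IsInvertible) (hd : ContDiffAt ℝ ∞ g z.1)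
    (hs : ∀ᶠ y in 𝓝 z.1, ∀ v w, g y v w = g y w v)
    (hz : 1 + modelCoInner g z.1 z.2 z.2 ≠ 0) (v : E) (a b : E →L[ℝ] ℝ) :
    fderiv ℝ (modelVert g) z (v, modelConn g z v) a b =
      - modelVert g z (a.comp (modelChristoffel g z.1 v)) b
      - modelVert g z a (b.comp (modelChristoffel g z.1 v)) := by
  have hV := ((contDiffAt_modelVert hg hd hz).differentiableAt (by simp)).hasFDerivAt
  have hC := ((contDiffAt_modelCoInner hg hd).differentiableAt (by simp)).hasFDerivAt
  have hC' := hC.comp z (hasFDerivAt_fst (𝕜 := ℝ))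
  have hab : HasFDerivAt (fun y : E × (E →L[ℝ] ℝ) ↦ modelCoInner g y.1 a b) _ z :=
    (hC'.clm_apply (hasFDerivAt_const a z)).clm_apply (hasFDerivAt_const b z)
  have haq (a : E →L[ℝ] ℝ) :
      HasFDerivAt (fun y : E × (E →L[ℝ] ℝ) ↦ modelCoInner g y.1 a y.2) _ z :=
    (hC'.clm_apply (hasFDerivAt_const a z)).clm_apply hasFDerivAt_snd
  have hqq : HasFDerivAt (fun y : E × (E →L[ℝ] ℝ) ↦ modelCoInner g y.1 y.2 y.2) _ z :=
    (hC'.clm_apply hasFDerivAt_snd).clm_apply hasFDerivAt_snd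
  have hinv := (hasDerivAt_inv hz).comp_hasFDerivAt z (hqq.const_add 1)
  have h1 := hinv.mul (hab.add ((haq a).mul (haq b)))
  have h2 := (hV.clm_apply (hasFDerivAt_const a z)).clm_apply (hasFDerivAt_const b z)
  have h3 := h1.congr_of_eventuallyEq (f₁ := fun y ↦ modelVert g y a b)
    (Filter.Eventually.of_forall fun y ↦ by
      change _ = (1 + modelCoInner g y.1 y.2 y.2)⁻¹ * _
      rw [← one_div]; rfl)
  have := congrArg (fun l : E × (E →L[ℝ] ℝ) →L[ℝ] ℝ ↦ l (v, modelConn g z v)) (h2.unique h3)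
  have hq : modelConn g z v = z.2.comp (modelChristoffel g z.1 v) := rfl
  have hd1 : ContDiffAt ℝ 1 g z.1 := hd.of_le (by simp)
  simp [fderiv_modelCoInner hg hd1 hs, hq] at this
  rw [hq, this]
  simp only [modelVert_apply]
  ring

theorem cyclic_phiTerm_model (hg : (g z.1).IsInvertible) (hd : ContDiffAt ℝ ∞ g z.1)
    (hs : ∀ᶠ y in 𝓝 z.1, ∀ v w, g y v w = g y w v)
    (hsV : ∀ a b, modelVert g z a b = modelVert g z b a)
    (hz : 1 + modelCoInner g z.1 z.2 z.2 ≠ 0) (hf : ContDiffAt ℝ ∞ f z.1)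
    (ξ η ζ : E × (E →L[ℝ] ℝ)) :
    phiTerm (modelMetric g f z) (modelJ g z) (fderiv ℝ (modelMetric g f) z)
        (fderiv ℝ (modelJ g) z) ξ η ζ +
      phiTerm (modelMetric g f z) (modelJ g z) (fderiv ℝ (modelMetric g f) z)
        (fderiv ℝ (modelJ g) z) η ζ ξ +
      phiTerm (modelMetric g f z) (modelJ g z) (fderiv ℝ (modelMetric g f) z)
        (fderiv ℝ (modelJ g) z) ζ ξ η = 0 := by
  -- All derivatives of f g and all derivatives of N along ξ disappear from a single summand, before
  -- any cyclic summation.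
  have key (ξ η ζ : E × (E →L[ℝ] ℝ)) :
      phiTerm (modelMetric g f z) (modelJ g z) (fderiv ℝ (modelMetric g f) z)
        (fderiv ℝ (modelJ g) z) ξ η ζ =
      2 * (modelVert g z ((modelVPart g z η).comp (modelChristoffel g z.1 ξ.1)) (modelVPart g z ζ)
        + modelVert g z (modelVPart g z η) ((modelVPart g z ζ).comp (modelChristoffel g z.1 ξ.1))
        - modelVert g z ((modelVPart g z ξ).comp (modelChristoffel g z.1 η.1)) (modelVPart g z ζ)
        - modelVert g z (modelVPart g z η)
            ((modelVPart g z ξ).comp (modelChristoffel g z.1 ζ.1))) := by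
    -- Two ways to write Jξ: the first isolates a horizontal direction, for differentiating V; the
    -- second isolates a vertical one, for differentiating N.
    have hJ₁ : modelJ g z ξ = ξ - (2 : ℝ) • (ξ.1, modelConn g z ξ.1) := by
      ext : 1
      · simp only [modelJ_apply, two_smul, Prod.fst_sub, Prod.fst_add]
        abel
      · simp only [modelJ_apply, two_smul, Prod.snd_sub, Prod.snd_add]
        abel
    have hJ₂ : modelJ g z ξ = (2 : ℝ) • (0, modelVPart g z ξ) - ξ := by
      ext : 1
      · simp [modelJ_apply]
      · simp only [modelJ_apply, modelVPart_apply, two_smul, Prod.snd_sub, Prod.snd_add]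
        abel
    simp only [phiTerm, fderiv_modelMetric hg hd hz hf, fderiv_modelJ hg hd, modelVPart_modelJ]
    rw [modelMetric_apply, modelVPart_apply g z (0, _)]
    have e1 : fderiv ℝ (modelVert g) z (modelJ g z ξ) =
        fderiv ℝ (modelVert g) z ξ - (2 : ℝ) •
          fderiv ℝ (modelVert g) z (ξ.1, modelConn g z ξ.1) := by
      rw [hJ₁, map_sub, map_smul]
    have e2 (x : E) : fderiv ℝ (modelConn g) z (modelJ g z ξ) x =
        (2 : ℝ) • (modelVPart g z ξ).comp (modelChristoffel g z.1 x) -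
          fderiv ℝ (modelConn g) z ξ x := by
      rw [← fderiv_modelConn_inr hg hd]
      rw [hJ₂, map_sub, map_smul]
      rfl
    simp only [e2, e1]
    have e3 : (modelJ g z ξ).1 = -ξ.1 := by simp [modelJ_apply]
    have e4 : (modelJ g z η).1 = -η.1 := by simp [modelJ_apply]
    simp only [e3, e4, map_neg, map_sub, map_smul, neg_apply,
      sub_apply, smul_apply, smul_eq_mul, map_zero,
      zero_apply, sub_zero, mul_zero,
      fderiv_modelVert_horizontal hg hd hs hz, hsV (fderiv ℝ (modelConn g) z ξ ζ.1)]
    ring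
  -- With the symmetry of V, the twelve terms are the six expressions V(a ∘ Γ(b), c), over
  -- permutations of the three arguments, each occurring once with either sign.
  rw [key, key, key, hsV (modelVPart g z η) ((modelVPart g z ζ).comp _),
    hsV (modelVPart g z η) ((modelVPart g z ξ).comp _),
    hsV (modelVPart g z ζ) ((modelVPart g z ξ).comp _),
    hsV (modelVPart g z ζ) ((modelVPart g z η).comp _),
    hsV (modelVPart g z ξ) ((modelVPart g z η).comp _),
    hsV (modelVPart g z ξ) ((modelVPart g z ζ).comp _)]
  ring

end Derivatives

end ModelCotangent

end Cotangent

/-! ### Transformation law of the Christoffel symbols -/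

namespace ManifoldTensor

/-- The transformation law of the Christoffel symbols under a change of coordinates `ψ`. -/
theorem modelChristoffel_transform {E : Type*} [NormedAddCommGroup E] [NormedSpace ℝ E]
    {G G₀ : E → E →L[ℝ] E →L[ℝ] ℝ} {ψ : E → E} {u : E} (hG : (G u).IsInvertible)
    (hG₀ : (G₀ (ψ u)).IsInvertible) (hs : ∀ v w, G₀ (ψ u) v w = G₀ (ψ u) w v)
    (hd : DifferentiableAt ℝ G₀ (ψ u)) (hdG : DifferentiableAt ℝ G u)
    (hψ : ContDiffAt ℝ 2 ψ u) (hinv : (fderiv ℝ ψ u).IsInvertible)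
    (h : ∀ᶠ y in 𝓝 u, ∀ v w, G y v w = G₀ (ψ y) (fderiv ℝ ψ y v) (fderiv ℝ ψ y w)) (v w : E) :
    modelChristoffel G₀ (ψ u) (fderiv ℝ ψ u v) (fderiv ℝ ψ u w) + fderiv ℝ (fderiv ℝ ψ) u v w =
      fderiv ℝ ψ u (modelChristoffel G u v w) := by
  have hT : DifferentiableAt ℝ (fderiv ℝ ψ) u :=
    (hψ.fderiv_right (m := 1) (by norm_num [one_add_one_eq_two])).differentiableAt one_ne_zero
  have hsymm (v w : E) : fderiv ℝ (fderiv ℝ ψ) u v w = fderiv ℝ (fderiv ℝ ψ) u w v :=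
    (hψ.isSymmSndFDerivAt (by simp)) v w
  have hψ' := (hψ.differentiableAt two_ne_zero).hasFDerivAt
  -- Derivative of the pulled-back metric. In the Koszul combination the symmetry of D²ψ removes all
  -- second-order terms except G₀(D²ψ(v,w), ψ'x).
  have hD (v w x : E) : fderiv ℝ G u x v w =
      fderiv ℝ G₀ (ψ u) (fderiv ℝ ψ u x) (fderiv ℝ ψ u v) (fderiv ℝ ψ u w) +
      G₀ (ψ u) (fderiv ℝ (fderiv ℝ ψ) u x v) (fderiv ℝ ψ u w) +
      G₀ (ψ u) (fderiv ℝ ψ u v) (fderiv ℝ (fderiv ℝ ψ) u x w) := by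
    have h1 : HasFDerivAt (fun y ↦ G₀ (ψ y) (fderiv ℝ ψ y v) (fderiv ℝ ψ y w)) _ u :=
      ((hd.hasFDerivAt.comp u hψ').clm_apply
        (hT.hasFDerivAt.clm_apply (hasFDerivAt_const v u))).clm_apply
        (hT.hasFDerivAt.clm_apply (hasFDerivAt_const w u))
    have h2 := h1.congr_of_eventuallyEq (f₁ := fun y ↦ G y v w) (h.mono fun y hy ↦ hy v w)
    have h3 := (hdG.hasFDerivAt.clm_apply (hasFDerivAt_const v u)).clm_apply
      (hasFDerivAt_const w u)
    have := congrArg (fun l : E →L[ℝ] ℝ ↦ l x) (h3.unique h2)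
    simp at this
    linarith
  have hinj : Function.Injective (G₀ (ψ u)) := by
    obtain ⟨e, he⟩ := hG₀
    rw [← he]
    exact e.injective
  -- Vectors are compared after lowering an index with G₀; every test vector is ψ'x for some x
  -- because the Jacobian is invertible.
  apply hinj
  ext y
  obtain ⟨x, rfl⟩ : ∃ x, fderiv ℝ ψ u x = y := by
    obtain ⟨e, he⟩ := hinv
    rw [← he]
    exact e.surjective y
  rw [← h.self_of_nhds, metric_modelChristoffel hG, map_add, add_apply,
    metric_modelChristoffel hG₀]
  simp only [koszulForm_apply, hD]
  rw [hs (fderiv ℝ ψ u w), hs (fderiv ℝ ψ u v) (fderiv ℝ (fderiv ℝ ψ) u w x), hs (fderiv ℝ ψ u v) (fderiv ℝ (fderiv ℝ ψ) u x w), hsymm w v, hsymm x v, hsymm x w]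
  ring

end ManifoldTensor

namespace ManifoldTensor

/-! ### Tensor fields, Lie brackets and covariant derivatives in a chart -/

section Coordinates

variable {E : Type*} [NormedAddCommGroup E] [NormedSpace ℝ E]
  {H : Type*} [TopologicalSpace H] {I : ModelWithCorners ℝ E H}
  {M : Type*} [TopologicalSpace M] [ChartedSpace H M]

/-- Continuity of F at p, required by manifold differentiability, is recovered from the local
expression, since F agrees with it composed with the chart near p. -/
theorem hasMFDerivAt_of_hasFDerivAt_comp_extChartAt_symm
    {W : Type*} [NormedAddCommGroup W] [NormedSpace ℝ W] {F : M → W} {p : M} {D : E →L[ℝ] W}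
    (h : HasFDerivAt (F ∘ (extChartAt I p).symm) D (extChartAt I p p)) :
    HasMFDerivAt I 𝓘(ℝ, W) F p D := by
  refine ⟨?_, h.hasFDerivWithinAt⟩
  have h1 : ContinuousAt ((F ∘ (extChartAt I p).symm) ∘ extChartAt I p) p :=
    h.continuousAt.comp (continuousAt_extChartAt p)
  refine h1.congr ?_
  filter_upwards [extChartAt_source_mem_nhds (I := I) p] with y hy
  simp only [Function.comp_apply, (extChartAt I p).left_inv hy]

variable [IsManifold I 1 M]

theorem symmL_eq_tangentCoordChange {p y : M} (hy : y ∈ (extChartAt I p).source) :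
    (trivializationAt E (TangentSpace I) p).symmL ℝ y = tangentCoordChange I p y y :=
  TangentBundle.symmL_trivializationAt_eq_core (by rwa [← extChartAt_source I])

theorem continuousLinearMapAt_eq_tangentCoordChange {p y : M}
    (hy : y ∈ (extChartAt I p).source) :
    (trivializationAt E (TangentSpace I) p).continuousLinearMapAt ℝ y = tangentCoordChange I y p y :=
  TangentBundle.continuousLinearMapAt_trivializationAt_eq_core (by rwa [← extChartAt_source I])

theorem tangentCoordChange_comp_symm {p y : M} (hy : y ∈ (extChartAt I p).source) (v : E) :
    tangentCoordChange I p y y (tangentCoordChange I y p y v) = v := by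
  rw [tangentCoordChange_comp ⟨⟨mem_extChartAt_source y, hy⟩, mem_extChartAt_source y⟩,
    tangentCoordChange_self (mem_extChartAt_source y)]

theorem tangentCoordChange_symm_comp {p y : M} (hy : y ∈ (extChartAt I p).source) (v : E) :
    tangentCoordChange I y p y (tangentCoordChange I p y y v) = v := by
  rw [tangentCoordChange_comp ⟨⟨hy, mem_extChartAt_source y⟩, hy⟩, tangentCoordChange_self hy]

theorem tangentCoordChange_diag (p : M) :
    tangentCoordChange I p p p = ContinuousLinearMap.id ℝ E := by
  ext v
  exact tangentCoordChange_self (mem_extChartAt_source p)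

/-- The components of a vector field at `y` in the preferred chart at `y`. -/
def rawVField (X : VField I M) (y : M) : E := X y

/-- The components of a `(1,1)`-tensor field at `y` in the preferred chart at `y`. -/
def raw11 (φ : Tensor11 I M) (y : M) : E →L[ℝ] E := φ y

/-- The components of a `(0,2)`-tensor field at `y` in the preferred chart at `y`. -/
def raw02 (G : Tensor02 I M) (y : M) : E →L[ℝ] E →L[ℝ] ℝ := G y

/-- A vector field in the chart at `p`. -/
def coordVField (X : VField I M) (p : M) (z : E) : E :=
  tangentCoordChange I ((extChartAt I p).symm z) p ((extChartAt I p).symm z)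
    (rawVField X ((extChartAt I p).symm z))

/-- A `(1,1)`-tensor field in the chart at `p`. -/
def coord11 (φ : Tensor11 I M) (p : M) (z : E) : E →L[ℝ] E :=
  (tangentCoordChange I ((extChartAt I p).symm z) p ((extChartAt I p).symm z)).comp
    ((raw11 φ ((extChartAt I p).symm z)).comp
      (tangentCoordChange I p ((extChartAt I p).symm z) ((extChartAt I p).symm z)))

/-- A `(0,2)`-tensor field in the chart at `p`. -/
def coord02 (G : Tensor02 I M) (p : M) (z : E) : E →L[ℝ] E →L[ℝ] ℝ :=
  pullbackForm (raw02 G ((extChartAt I p).symm z))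
    (tangentCoordChange I p ((extChartAt I p).symm z) ((extChartAt I p).symm z))

theorem coordVField_self (X : VField I M) (p : M) :
    coordVField X p (extChartAt I p p) = rawVField X p := by
  rw [coordVField, extChartAt_to_inv, tangentCoordChange_self (mem_extChartAt_source p)]

theorem coord11_self (φ : Tensor11 I M) (p : M) : coord11 φ p (extChartAt I p p) = raw11 φ p := by
  rw [coord11, extChartAt_to_inv, tangentCoordChange_diag]
  rfl

theorem coord02_self (G : Tensor02 I M) (p : M) : coord02 G p (extChartAt I p p) = raw02 G p := by
  rw [coord02, extChartAt_to_inv, tangentCoordChange_diag]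
  rfl

theorem components_eq_coord02 (G : Tensor02 I M) (p : M) {z : E} (hz : z ∈ (extChartAt I p).target) :
    components G p ((extChartAt I p).symm z) = coord02 G p z := by
  have h := symmL_eq_tangentCoordChange ((extChartAt I p).map_target hz)
  exact congrArg (pullbackForm (V := E) (W := E) (raw02 G ((extChartAt I p).symm z))) h

theorem coordVField_apply11 (φ : Tensor11 I M) (X : VField I M) (p : M) {z : E}
    (hz : z ∈ (extChartAt I p).target) :
    coordVField (fun y ↦ φ y (X y)) p z = coord11 φ p z (coordVField X p z) := by
  simp only [coord11, coordVField, ContinuousLinearMap.comp_apply]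
  rw [tangentCoordChange_comp_symm ((extChartAt I p).map_target hz)]
  rfl

theorem coord02_apply (G : Tensor02 I M) (X Y : VField I M) (p : M) {z : E}
    (hz : z ∈ (extChartAt I p).target) :
    coord02 G p z (coordVField X p z) (coordVField Y p z) =
      G ((extChartAt I p).symm z) (X ((extChartAt I p).symm z)) (Y ((extChartAt I p).symm z)) := by
  have h := tangentCoordChange_comp_symm ((extChartAt I p).map_target hz)
  simp only [coord02, coordVField, pullbackForm_apply]
  rw [h, h]
  rfl

theorem coord02_pure {G : Tensor02 I M} {φ : Tensor11 I M}
    (h : ∀ (x : M) (v w : TangentSpace I x), G x (φ x v) w = G x v (φ x w)) (p : M) {z : E}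
    (hz : z ∈ (extChartAt I p).target) (v w : E) :
    coord02 G p z (coord11 φ p z v) w = coord02 G p z v (coord11 φ p z w) := by
  have h' := tangentCoordChange_comp_symm ((extChartAt I p).map_target hz)
  simp only [coord02, coord11, pullbackForm_apply, ContinuousLinearMap.comp_apply]
  rw [h', h']
  exact h _ _ _

section Boundaryless

variable [I.Boundaryless]

theorem differentiableAt_coordVField {X : VField I M} (hX : SmoothVField X) (p : M) :
    DifferentiableAt ℝ (coordVField X p) (extChartAt I p p) := by
  have h1 := (contMDiffAt_section p).1 (hX p)
  have h2 := (contMDiffAt_iff.1 h1).2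
  rw [I.range_eq_univ, contDiffWithinAt_univ] at h2
  exact h2.differentiableAt (by simp)

/-- The manifold bracket is the bracket of the fields pulled back by the inverse chart. Near the
centre these pullbacks are the coordinate fields, and at p the chart has identity derivative. -/
theorem mlieBracket_eq_lieBracket (X Y : VField I M) (p : M) :
    VectorField.mlieBracket I X Y p =
      VectorField.lieBracket ℝ (coordVField X p) (coordVField Y p) (extChartAt I p p) := by
  have hpull (X : VField I M) : VectorField.mpullbackWithin 𝓘(ℝ, E) I (extChartAt I p).symm X
      (Set.range I) =ᶠ[𝓝 (extChartAt I p p)] coordVField X p := by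
    filter_upwards [extChartAt_target_mem_nhds (I := I) p] with z hz
    have hy := (extChartAt I p).map_target hz
    have e1 := TangentBundle.symmL_trivializationAt (I := I) (x₀ := p)
      (x := (extChartAt I p).symm z) (by rwa [← extChartAt_source I])
    rw [(extChartAt I p).right_inv hz, symmL_eq_tangentCoordChange hy] at e1
    rw [VectorField.mpullbackWithin_apply, ← e1]
    have e2 : (tangentCoordChange I p ((extChartAt I p).symm z) ((extChartAt I p).symm z)).inverse =
        tangentCoordChange I ((extChartAt I p).symm z) p ((extChartAt I p).symm z) := by
      apply ContinuousLinearMap.inverse_eq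
      · ext v; exact tangentCoordChange_comp_symm hy v
      · ext v; exact tangentCoordChange_symm_comp hy v
    exact congrArg (fun A : E →L[ℝ] E ↦ A (X ((extChartAt I p).symm z))) e2
  rw [← VectorField.mlieBracketWithin_univ, VectorField.mlieBracketWithin_apply]
  have e3 : mfderiv I 𝓘(ℝ, E) (extChartAt I p) p = ContinuousLinearMap.id ℝ E := by
    rw [← TangentBundle.continuousLinearMapAt_trivializationAt (mem_chart_source H p),
      continuousLinearMapAt_eq_tangentCoordChange (mem_extChartAt_source p)]
    exact tangentCoordChange_diag p
  rw [e3, Set.preimage_univ, Set.univ_inter]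
  have e4 : ContinuousLinearMap.inverse (ContinuousLinearMap.id ℝ E) =
    ContinuousLinearMap.id ℝ E := ContinuousLinearMap.inverse_id
  refine (congrArg (fun A : E →L[ℝ] E ↦ A _) e4).trans ?_
  have e5 : Set.range I = Set.univ := I.range_eq_univ
  rw [e5] at hpull ⊢
  refine (congrFun VectorField.lieBracketWithin_univ _).trans ?_
  exact Filter.EventuallyEq.lieBracket_vectorField_eq (hpull X) (hpull Y)

theorem dComponents_eq {G : Tensor02 I M} {p : M}
    (hG : DifferentiableAt ℝ (coord02 G p) (extChartAt I p p)) :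
    dComponents G p = fderiv ℝ (coord02 G p) (extChartAt I p p) := by
  refine (hasMFDerivAt_of_hasFDerivAt_comp_extChartAt_symm
    (hG.hasFDerivAt.congr_of_eventuallyEq ?_)).mfderiv
  filter_upwards [extChartAt_target_mem_nhds (I := I) p] with z hz
  exact components_eq_coord02 G p hz

omit [I.Boundaryless] in
theorem leviCivita_eq {G : Tensor02 I M} {p : M} (X Y : VField I M)
    (hY : DifferentiableAt ℝ (coordVField Y p) (extChartAt I p p)) :
    leviCivita G X Y p = (fderiv ℝ (coordVField Y p) (extChartAt I p p) (rawVField X p) +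
      christoffel G p (rawVField X p) (rawVField Y p) : E) := by
  have h : mfderiv I 𝓘(ℝ, E) (fun y : M ↦ (trivializationAt E (TangentSpace I) p ⟨y, Y y⟩).2) p =
      fderiv ℝ (coordVField Y p) (extChartAt I p p) :=
    (hasMFDerivAt_of_hasFDerivAt_comp_extChartAt_symm (p := p) (I := I)
      (F := fun y : M ↦ (trivializationAt E (TangentSpace I) p ⟨y, Y y⟩).2) hY.hasFDerivAt).mfderiv
  exact congrArg (fun D : E →L[ℝ] E ↦ D (rawVField X p) + christoffel G p (rawVField X p) (rawVField Y p)) h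

omit [IsManifold I 1 M] in
theorem dirDeriv_eq {p : M} (X : VField I M) {h : M → ℝ}
    {h' : E → ℝ} (hh : DifferentiableAt ℝ h' (extChartAt I p p))
    (he : ∀ z ∈ (extChartAt I p).target, h' z = h ((extChartAt I p).symm z)) :
    dirDeriv X h p = fderiv ℝ h' (extChartAt I p p) (rawVField X p) := by
  have e : mfderiv I 𝓘(ℝ, ℝ) h p = fderiv ℝ h' (extChartAt I p p) := by
    refine (hasMFDerivAt_of_hasFDerivAt_comp_extChartAt_symm
      (hh.hasFDerivAt.congr_of_eventuallyEq ?_)).mfderiv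
    filter_upwards [extChartAt_target_mem_nhds (I := I) p] with z hz
    exact (he z hz).symm
  exact congrArg (fun D : E →L[ℝ] ℝ ↦ D (rawVField X p)) e

theorem differentiableAt_coordVField_apply11 {φ : Tensor11 I M} {X : VField I M} {p : M}
    (hφ : DifferentiableAt ℝ (coord11 φ p) (extChartAt I p p))
    (hX : DifferentiableAt ℝ (coordVField X p) (extChartAt I p p)) :
    HasFDerivAt (coordVField (fun y ↦ φ y (X y)) p)
      ((coord11 φ p (extChartAt I p p)).comp (fderiv ℝ (coordVField X p) (extChartAt I p p)) +
        (fderiv ℝ (coord11 φ p) (extChartAt I p p)).flip (coordVField X p (extChartAt I p p)))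
      (extChartAt I p p) := by
  refine (hφ.hasFDerivAt.clm_apply hX.hasFDerivAt).congr_of_eventuallyEq ?_
  filter_upwards [extChartAt_target_mem_nhds (I := I) p] with z hz
  exact coordVField_apply11 φ X p hz

/-- The derivative of Y cancels between ∇(φY) and φ(∇Y). Lowering the index turns the Christoffel
terms into Koszul forms, and purity moves φ from Γ(X,Y) onto Z. -/
theorem metric_covDeriv11 {G : Tensor02 I M} {φ : Tensor11 I M} {p : M} {X Y Z : VField I M}
    (hinv : (raw02 G p).IsInvertible)
    (hpure : ∀ v w : TangentSpace I p, G p (φ p v) w = G p v (φ p w))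
    (hG : DifferentiableAt ℝ (coord02 G p) (extChartAt I p p))
    (hφ : DifferentiableAt ℝ (coord11 φ p) (extChartAt I p p))
    (hY : DifferentiableAt ℝ (coordVField Y p) (extChartAt I p p)) :
    G p (covDeriv11 G φ X Y p) (Z p) =
      (coord02 G p (extChartAt I p p)
        (fderiv ℝ (coord11 φ p) (extChartAt I p p) (rawVField X p) (rawVField Y p)) (rawVField Z p)) +
      koszulForm (fderiv ℝ (coord02 G p) (extChartAt I p p)) (rawVField X p)
        (coord11 φ p (extChartAt I p p) (rawVField Y p)) (rawVField Z p) -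
      koszulForm (fderiv ℝ (coord02 G p) (extChartAt I p p)) (rawVField X p) (rawVField Y p)
        (coord11 φ p (extChartAt I p p) (rawVField Z p)) := by
  have hφY := differentiableAt_coordVField_apply11 hφ hY
  have hC (v w u : E) : raw02 G p (christoffel G p v w) u =
      koszulForm (fderiv ℝ (coord02 G p) (extChartAt I p p)) v w u := by
    rw [← dComponents_eq hG]
    exact congrArg (fun l : E →L[ℝ] ℝ ↦ l u)
      (apply_inverse_of_isInvertible hinv (christoffelFirst G p v w))
  have h1 : rawVField (leviCivita G X (fun y ↦ φ y (Y y))) p = _ :=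
    leviCivita_eq X (fun y ↦ φ y (Y y)) hφY.differentiableAt
  have h2 : rawVField (leviCivita G X Y) p = _ := leviCivita_eq X Y hY
  rw [hφY.fderiv, coord11_self, coordVField_self] at h1
  change raw02 G p (rawVField (leviCivita G X (fun y ↦ φ y (Y y))) p -
    raw11 φ p (rawVField (leviCivita G X Y) p))
    (rawVField Z p) = _
  rw [h1, h2, coord11_self, coord02_self]
  set D := fderiv ℝ (coordVField Y p) (extChartAt I p p) with hD
  set D' := fderiv ℝ (coord11 φ p) (extChartAt I p p) with hD'
  have key (B : E →L[ℝ] E →L[ℝ] ℝ) (A : E →L[ℝ] E) (x y z c c' : E)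
      (hB : ∀ v w, B (A v) w = B v (A w)) :
      B (((A.comp D + D'.flip y) x + c) - A (D x + c')) z = B (D' x y) z + B c z - B c' (A z) := by
    rw [← hB]
    simp only [add_apply, ContinuousLinearMap.comp_apply, ContinuousLinearMap.flip_apply, map_add,
      map_sub, sub_apply]
    ring
  rw [← hC, ← hC]
  exact key (raw02 G p) (raw11 φ p) (rawVField X p) (rawVField Y p) (rawVField Z p) _ _ hpure

theorem cyclic_metric_covDeriv11 {G : Tensor02 I M} {φ : Tensor11 I M} {p : M}
    {X Y Z : VField I M}
    (hinv : (raw02 G p).IsInvertible)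
    (hsymm : ∀ (x : M) (v w : TangentSpace I x), G x v w = G x w v)
    (hpure : ∀ (x : M) (v w : TangentSpace I x), G x (φ x v) w = G x v (φ x w))
    (hG : DifferentiableAt ℝ (coord02 G p) (extChartAt I p p))
    (hφ : DifferentiableAt ℝ (coord11 φ p) (extChartAt I p p))
    (hX : DifferentiableAt ℝ (coordVField X p) (extChartAt I p p))
    (hY : DifferentiableAt ℝ (coordVField Y p) (extChartAt I p p))
    (hZ : DifferentiableAt ℝ (coordVField Z p) (extChartAt I p p)) :
    letI S := phiTerm (coord02 G p (extChartAt I p p)) (coord11 φ p (extChartAt I p p))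
      (fderiv ℝ (coord02 G p) (extChartAt I p p)) (fderiv ℝ (coord11 φ p) (extChartAt I p p))
    G p (covDeriv11 G φ X Y p) (Z p) + G p (covDeriv11 G φ Y Z p) (X p) +
      G p (covDeriv11 G φ Z X p) (Y p) =
      S (rawVField X p) (rawVField Y p) (rawVField Z p) + S (rawVField Y p) (rawVField Z p) (rawVField X p) + S (rawVField Z p) (rawVField X p) (rawVField Y p) := by
  rw [metric_covDeriv11 hinv (hpure p) hG hφ hY, metric_covDeriv11 hinv (hpure p) hG hφ hZ,
    metric_covDeriv11 hinv (hpure p) hG hφ hX]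
  have hs (z : E) (v w : E) : coord02 G p z v w = coord02 G p z w v := hsymm _ _ _
  exact cyclic_covDeriv_eq_phiTerm (hs _)
    (symm_fderiv hG (Filter.Eventually.of_forall hs))
    (pure_fderiv hG hφ (Filter.eventually_of_mem (extChartAt_target_mem_nhds p)
      fun z hz ↦ coord02_pure hpure p hz)) (rawVField X p) (rawVField Y p) (rawVField Z p)

theorem lieDeriv11_eq {φ : Tensor11 I M} {p : M} {X Y : VField I M}
    (hφ : DifferentiableAt ℝ (coord11 φ p) (extChartAt I p p))
    (hX : DifferentiableAt ℝ (coordVField X p) (extChartAt I p p)) :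
    lieDeriv11 Y φ X p = (fderiv ℝ (coord11 φ p) (extChartAt I p p) (rawVField Y p) (rawVField X p) -
      fderiv ℝ (coordVField Y p) (extChartAt I p p) (coord11 φ p (extChartAt I p p) (rawVField X p)) +
      coord11 φ p (extChartAt I p p)
        (fderiv ℝ (coordVField Y p) (extChartAt I p p) (rawVField X p)) : E) := by
  have hφX := differentiableAt_coordVField_apply11 hφ hX
  have h1 : rawVField (VectorField.mlieBracket I Y (fun y ↦ φ y (X y))) p = _ :=
    mlieBracket_eq_lieBracket Y (fun y ↦ φ y (X y)) p
  have h2 : rawVField (VectorField.mlieBracket I Y X) p = _ := mlieBracket_eq_lieBracket Y X p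
  simp only [VectorField.lieBracket] at h1 h2
  rw [hφX.fderiv, coordVField_self, coordVField_apply11 φ X p (mem_extChartAt_target p),
    coordVField_self, coord11_self] at h1
  rw [coordVField_self, coordVField_self] at h2
  change rawVField (VectorField.mlieBracket I Y (fun y ↦ φ y (X y))) p -
    raw11 φ p (rawVField (VectorField.mlieBracket I Y X) p) = _
  rw [h1, h2, coord11_self, coordVField_self]
  have key (A D₁ D₂ : E →L[ℝ] E) (D' : E →L[ℝ] E →L[ℝ] E) (x y : E) :
      ((A.comp D₁ + D'.flip x) y - D₂ (A x)) - A (D₁ y - D₂ x) =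
        D' y x - D₂ (A x) + A (D₂ x) := by
    simp only [add_apply, ContinuousLinearMap.comp_apply, ContinuousLinearMap.flip_apply, map_sub]
    abel
  exact key (raw11 φ p) _ _ _ (rawVField X p) (rawVField Y p)

/-- The operator is tensorial. Derivatives of X already cancel in the Lie derivative of φ, those of
Y cancel between the directional derivatives and L_Y φ, and those of Z do so with the help of
purity. -/
theorem PhiOp_eq {G : Tensor02 I M} {φ : Tensor11 I M} {p : M}
    {X Y Z : VField I M}
    (hpure : ∀ v w : TangentSpace I p, G p (φ p v) w = G p v (φ p w))
    (hG : DifferentiableAt ℝ (coord02 G p) (extChartAt I p p))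
    (hφ : DifferentiableAt ℝ (coord11 φ p) (extChartAt I p p))
    (hX : DifferentiableAt ℝ (coordVField X p) (extChartAt I p p))
    (hY : DifferentiableAt ℝ (coordVField Y p) (extChartAt I p p))
    (hZ : DifferentiableAt ℝ (coordVField Z p) (extChartAt I p p)) :
    letI B := coord02 G p (extChartAt I p p)
    letI A := coord11 φ p (extChartAt I p p)
    letI dB := fderiv ℝ (coord02 G p) (extChartAt I p p)
    letI dA := fderiv ℝ (coord11 φ p) (extChartAt I p p)
    PhiOp φ G X Y Z p =
      dB (A (rawVField X p)) (rawVField Y p) (rawVField Z p) - dB (rawVField X p) (A (rawVField Y p)) (rawVField Z p) - B (dA (rawVField X p) (rawVField Y p)) (rawVField Z p) +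
        B (dA (rawVField Y p) (rawVField X p)) (rawVField Z p) + B (rawVField Y p) (dA (rawVField Z p) (rawVField X p)) := by
  have hφY := differentiableAt_coordVField_apply11 hφ hY
  have h1 := (hG.hasFDerivAt.clm_apply hY.hasFDerivAt).clm_apply hZ.hasFDerivAt
  have h2 := (hG.hasFDerivAt.clm_apply hφY).clm_apply hZ.hasFDerivAt
  rw [PhiOp, dirDeriv_eq _ h1.differentiableAt fun z hz ↦ coord02_apply G Y Z p hz,
    dirDeriv_eq _ h2.differentiableAt fun z hz ↦ coord02_apply G (fun y ↦ φ y (Y y)) Z p hz,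
    lieDeriv11_eq hφ hX, lieDeriv11_eq hφ hX, h1.fderiv, h2.fderiv, coordVField_self,
    coordVField_self, coordVField_self, coord11_self, coord02_self]
  set DX := fderiv ℝ (coordVField X p) (extChartAt I p p)
  set DY := fderiv ℝ (coordVField Y p) (extChartAt I p p)
  set DZ := fderiv ℝ (coordVField Z p) (extChartAt I p p)
  set dA := fderiv ℝ (coord11 φ p) (extChartAt I p p)
  set dB := fderiv ℝ (coord02 G p) (extChartAt I p p)
  have key (B : E →L[ℝ] E →L[ℝ] ℝ) (A : E →L[ℝ] E) (x y z : E)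
      (hB : ∀ v w, B (A v) w = B v (A w)) :
      ((B y).comp DZ + (B.comp DY + dB.flip y).flip z) (A x) -
        ((B (A y)).comp DZ + (B.comp (A.comp DY + dA.flip y) + dB.flip (A y)).flip z) x +
        B (dA y x - DY (A x) + A (DY x)) z + B y (dA z x - DZ (A x) + A (DZ x)) =
      dB (A x) y z - dB x (A y) z - B (dA x y) z + B (dA y x) z + B y (dA z x) := by
    simp only [add_apply, ContinuousLinearMap.comp_apply, ContinuousLinearMap.flip_apply, map_sub,
      map_add, sub_apply, hB]
    ring
  exact key (raw02 G p) (raw11 φ p) (rawVField X p) (rawVField Y p) (rawVField Z p) hpure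

theorem cyclic_PhiOp {G : Tensor02 I M} {φ : Tensor11 I M} {p : M}
    {X Y Z : VField I M}
    (hsymm : ∀ (x : M) (v w : TangentSpace I x), G x v w = G x w v)
    (hpure : ∀ (x : M) (v w : TangentSpace I x), G x (φ x v) w = G x v (φ x w))
    (hG : DifferentiableAt ℝ (coord02 G p) (extChartAt I p p))
    (hφ : DifferentiableAt ℝ (coord11 φ p) (extChartAt I p p))
    (hX : DifferentiableAt ℝ (coordVField X p) (extChartAt I p p))
    (hY : DifferentiableAt ℝ (coordVField Y p) (extChartAt I p p))
    (hZ : DifferentiableAt ℝ (coordVField Z p) (extChartAt I p p)) :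
    letI S := phiTerm (coord02 G p (extChartAt I p p)) (coord11 φ p (extChartAt I p p))
      (fderiv ℝ (coord02 G p) (extChartAt I p p)) (fderiv ℝ (coord11 φ p) (extChartAt I p p))
    PhiOp φ G X Y Z p + PhiOp φ G Y Z X p + PhiOp φ G Z X Y p =
      S (rawVField X p) (rawVField Y p) (rawVField Z p) + S (rawVField Y p) (rawVField Z p) (rawVField X p) + S (rawVField Z p) (rawVField X p) (rawVField Y p) := by
  rw [PhiOp_eq (hpure p) hG hφ hX hY hZ, PhiOp_eq (hpure p) hG hφ hY hZ hX,
    PhiOp_eq (hpure p) hG hφ hZ hX hY]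
  have hs (z : E) (v w : E) : coord02 G p z v w = coord02 G p z w v := hsymm _ _ _
  exact cyclic_phi_eq_phiTerm (hs _) (rawVField X p) (rawVField Y p) (rawVField Z p)

end Boundaryless

end Coordinates

end ManifoldTensor

namespace ManifoldTensor

/-! ### Smoothness of tensor fields versus smoothness of their components -/

section Smoothness

variable {E : Type*} [NormedAddCommGroup E] [NormedSpace ℝ E]
  {H : Type*} [TopologicalSpace H] {I : ModelWithCorners ℝ E H}
  {M : Type*} [TopologicalSpace M] [ChartedSpace H M]

theorem contMDiffAt_of_contDiffAt_comp_extChartAt_symm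
    {W : Type*} [NormedAddCommGroup W] [NormedSpace ℝ W] {n : ℕ∞ω} {F : M → W} {p : M}
    (h : ContDiffAt ℝ n (F ∘ (extChartAt I p).symm) (extChartAt I p p)) :
    ContMDiffAt I 𝓘(ℝ, W) n F p := by
  rw [contMDiffAt_iff]
  refine ⟨?_, h.contDiffWithinAt⟩
  have h1 : ContinuousAt ((F ∘ (extChartAt I p).symm) ∘ extChartAt I p) p :=
    h.continuousAt.comp (continuousAt_extChartAt p)
  refine h1.congr ?_
  filter_upwards [extChartAt_source_mem_nhds (I := I) p] with y hy
  simp only [Function.comp_apply, (extChartAt I p).left_inv hy]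

variable [IsManifold I ∞ M] [IsManifold I 1 M]

omit [IsManifold I ∞ M] in
theorem hom_trivializationAt_snd_eq_coord11 (φ : Tensor11 I M) (p : M) {z : E}
    (hz : z ∈ (extChartAt I p).target) :
    (trivializationAt (E →L[ℝ] E) (fun x : M ↦ TangentSpace I x →L[ℝ] TangentSpace I x) p
      ⟨(extChartAt I p).symm z, φ ((extChartAt I p).symm z)⟩).2 = coord11 φ p z := by
  have hy := (extChartAt I p).map_target hz
  have h1 := symmL_eq_tangentCoordChange hy
  have h2 := continuousLinearMapAt_eq_tangentCoordChange hy
  rw [coord11, ← h1, ← h2]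
  rfl

omit [IsManifold I ∞ M] in
-- Bilinear forms form an iterated hom-bundle, so the trivialization is unfolded twice; the outer
-- fibre map is the trivialization only over its base set.
theorem hom_trivializationAt_snd_eq_coord02 (G : Tensor02 I M) (p : M) {z : E}
    (hz : z ∈ (extChartAt I p).target) :
    (trivializationAt (E →L[ℝ] E →L[ℝ] ℝ)
      (fun x : M ↦ TangentSpace I x →L[ℝ] TangentSpace I x →L[ℝ] ℝ) p
      ⟨(extChartAt I p).symm z, G ((extChartAt I p).symm z)⟩).2 = coord02 G p z := by
  have hy := (extChartAt I p).map_target hz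
  have h1 := symmL_eq_tangentCoordChange hy
  rw [coord02, ← h1]
  ext v w
  rw [hom_trivializationAt_apply]
  simp only [ContinuousLinearMap.inCoordinates, ContinuousLinearMap.comp_apply]
  rw [Trivialization.continuousLinearMapAt_apply, Trivialization.linearMapAt_apply]
  rw [if_pos]
  swap
  · rw [hom_trivializationAt_baseSet]
    exact ⟨by rwa [TangentBundle.trivializationAt_baseSet, ← extChartAt_source I], trivial⟩
  rw [hom_trivializationAt_apply]
  simp only [ContinuousLinearMap.inCoordinates, ContinuousLinearMap.comp_apply]
  simp
  rfl

variable [I.Boundaryless]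

omit [IsManifold I ∞ M] in
theorem contMDiff_of_coord11 {φ : Tensor11 I M}
    (h : ∀ p, ContDiffAt ℝ ∞ (coord11 φ p) (extChartAt I p p)) :
    ContMDiff I (I.prod 𝓘(ℝ, E →L[ℝ] E)) ∞
    (fun x ↦ TotalSpace.mk' (E →L[ℝ] E) (E := fun x : M ↦ TangentSpace I x →L[ℝ] TangentSpace I x)
      x (φ x)) := by
  intro p
  rw [contMDiffAt_section]
  apply contMDiffAt_of_contDiffAt_comp_extChartAt_symm
  refine (h p).congr_of_eventuallyEq ?_
  filter_upwards [extChartAt_target_mem_nhds (I := I) p] with z hz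
  exact hom_trivializationAt_snd_eq_coord11 φ p hz

omit [IsManifold I ∞ M] in
theorem contMDiff_of_coord02 {G : Tensor02 I M}
    (h : ∀ p, ContDiffAt ℝ ∞ (coord02 G p) (extChartAt I p p)) :
    ContMDiff I (I.prod 𝓘(ℝ, E →L[ℝ] E →L[ℝ] ℝ)) ∞
    (fun x ↦ TotalSpace.mk' (E →L[ℝ] E →L[ℝ] ℝ)
      (E := fun x : M ↦ TangentSpace I x →L[ℝ] TangentSpace I x →L[ℝ] ℝ) x (G x)) := by
  intro p
  rw [contMDiffAt_section]
  apply contMDiffAt_of_contDiffAt_comp_extChartAt_symm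
  refine (h p).congr_of_eventuallyEq ?_
  filter_upwards [extChartAt_target_mem_nhds (I := I) p] with z hz
  exact hom_trivializationAt_snd_eq_coord02 G p hz

/-- Smoothness is needed at every point of the chart, not only at its centre: Christoffel symbols in
a fixed chart are later evaluated at neighbouring points. -/
theorem contDiffAt_coord02 {G : Tensor02 I M}
    (h : ContMDiff I (I.prod 𝓘(ℝ, E →L[ℝ] E →L[ℝ] ℝ)) ∞
      (fun x ↦ TotalSpace.mk' (E →L[ℝ] E →L[ℝ] ℝ)
      (E := fun x : M ↦ TangentSpace I x →L[ℝ] TangentSpace I x →L[ℝ] ℝ) x (G x)))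
    (p : M) {z : E} (hz : z ∈ (extChartAt I p).target) :
    ContDiffAt ℝ ∞ (coord02 G p) z := by
  have ht : (extChartAt I p).target ∈ 𝓝 z := (isOpen_extChartAt_target p).mem_nhds hz
  have hb : (extChartAt I p).symm z ∈ (trivializationAt (E →L[ℝ] E →L[ℝ] ℝ)
      (fun x : M ↦ TangentSpace I x →L[ℝ] TangentSpace I x →L[ℝ] ℝ) p).baseSet := by
    have hy := (extChartAt I p).map_target hz
    rw [extChartAt_source] at hy
    rw [hom_trivializationAt_baseSet, hom_trivializationAt_baseSet]
    exact ⟨hy, hy, trivial⟩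
  have h1 := (Trivialization.contMDiffAt_section_iff (IB := I) _ hb).1
    (h ((extChartAt I p).symm z))
  have h2 : ContMDiffAt 𝓘(ℝ, E) I ∞ (extChartAt I p).symm z :=
    (contMDiffOn_extChartAt_symm p).contMDiffAt ht
  have h3 := contMDiffAt_iff_contDiffAt.1 (h1.comp z h2)
  refine h3.congr_of_eventuallyEq ?_
  filter_upwards [ht] with y hy
  exact (hom_trivializationAt_snd_eq_coord02 G p hy).symm

end Smoothness

end ManifoldTensor

namespace ManifoldTensor

/-! ### Change of chart on the base -/

section CoordChange

variable {E : Type*} [NormedAddCommGroup E] [NormedSpace ℝ E]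
  {H : Type*} [TopologicalSpace H] {I : ModelWithCorners ℝ E H} [I.Boundaryless]
  {M : Type*} [TopologicalSpace M] [ChartedSpace H M] [IsManifold I ∞ M] [IsManifold I 1 M]

variable (I) in
/-- The transition map from the chart at `x` to the chart at `x₀`. -/
def transition (x x₀ : M) : E → E := extChartAt I x₀ ∘ (extChartAt I x).symm

omit [IsManifold I ∞ M] in
theorem fderiv_transition (x x₀ : M) {z : E} (hz : z ∈ (extChartAt I x).target) :
    fderiv ℝ (transition I x x₀) z = tangentCoordChange I x x₀ ((extChartAt I x).symm z) := by
  rw [tangentCoordChange_def, I.range_eq_univ, fderivWithin_univ, (extChartAt I x).right_inv hz]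
  rfl

omit [IsManifold I ∞ M] [IsManifold I 1 M] in
theorem eventually_mem_target_and_symm_mem_source {x x₀ : M} (hx : x ∈ (extChartAt I x₀).source) :
    ∀ᶠ z in 𝓝 (extChartAt I x x), z ∈ (extChartAt I x).target ∧
      (extChartAt I x).symm z ∈ (extChartAt I x₀).source := by
  have h2 : ContinuousAt (extChartAt I x).symm (extChartAt I x x) :=
    continuousAt_extChartAt_symm x
  have h3 : (extChartAt I x₀).source ∈ 𝓝 ((extChartAt I x).symm (extChartAt I x x)) := by
    rw [extChartAt_to_inv]
    exact extChartAt_source_mem_nhds' hx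
  filter_upwards [extChartAt_target_mem_nhds (I := I) x, h2.preimage_mem_nhds h3] with z h h'
  exact ⟨h, h'⟩

omit [IsManifold I 1 M] in
theorem contDiffAt_transition {x x₀ : M} (hx : x ∈ (extChartAt I x₀).source) :
    ContDiffAt ℝ ∞ (transition I x x₀) (extChartAt I x x) := by
  have h := contDiffWithinAt_ext_coord_change (I := I) (n := ∞) x₀ x (y := extChartAt I x x) (by
    rw [PartialEquiv.trans_source'', PartialEquiv.symm_symm, PartialEquiv.symm_target]
    exact Set.mem_image_of_mem _ ⟨mem_extChartAt_source x, hx⟩)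
  rwa [I.range_eq_univ, contDiffWithinAt_univ] at h

omit [IsManifold I ∞ M] [I.Boundaryless] in
theorem isInvertible_tangentCoordChange {x x₀ y : M} (hx : y ∈ (extChartAt I x).source)
    (hx₀ : y ∈ (extChartAt I x₀).source) : (tangentCoordChange I x x₀ y).IsInvertible := by
  refine ContinuousLinearMap.IsInvertible.of_inverse (g := tangentCoordChange I x₀ x y) ?_ ?_
  · ext v
    exact (tangentCoordChange_comp ⟨⟨hx₀, hx⟩, hx₀⟩).trans (tangentCoordChange_self hx₀)
  · ext v
    exact (tangentCoordChange_comp ⟨⟨hx, hx₀⟩, hx⟩).trans (tangentCoordChange_self hx)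

omit [IsManifold I ∞ M] in
theorem coord02_transition (G : Tensor02 I M) {x x₀ : M} {z : E}
    (hz : z ∈ (extChartAt I x).target)
    (hz₀ : (extChartAt I x).symm z ∈ (extChartAt I x₀).source) (v w : E) :
    coord02 G x z v w = coord02 G x₀ (transition I x x₀ z)
      (fderiv ℝ (transition I x x₀) z v) (fderiv ℝ (transition I x x₀) z w) := by
  have hy := (extChartAt I x).map_target hz
  rw [fderiv_transition x x₀ hz]
  simp only [coord02, transition, Function.comp_apply, pullbackForm_apply]
  rw [(extChartAt I x₀).left_inv hz₀]
  have h (v : E) := tangentCoordChange_comp (I := I) (v := v)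
    ⟨⟨hy, hz₀⟩, mem_extChartAt_source ((extChartAt I x).symm z)⟩
  rw [h, h]

omit [IsManifold I ∞ M] [I.Boundaryless] in
theorem isInvertible_coord02 {G : Tensor02 I M} (hG : ∀ x, (raw02 G x).IsInvertible) (p : M)
    {z : E} (hz : z ∈ (extChartAt I p).target) : (coord02 G p z).IsInvertible := by
  obtain ⟨e, he⟩ := isInvertible_tangentCoordChange (I := I) ((extChartAt I p).map_target hz)
    (mem_extChartAt_source _)
  obtain ⟨e', he'⟩ := hG ((extChartAt I p).symm z)
  refine ⟨(e.trans e').trans (e.symm.arrowCongr (ContinuousLinearEquiv.refl ℝ ℝ)), ?_⟩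
  rw [coord02, ← he, ← he']
  ext v w
  simp

omit [IsManifold I ∞ M] in
theorem christoffel_eq_modelChristoffel {G : Tensor02 I M} {p : M}
    (hG : DifferentiableAt ℝ (coord02 G p) (extChartAt I p p)) :
    christoffel G p = modelChristoffel (coord02 G p) (extChartAt I p p) := by
  rw [christoffel, christoffelFirst, dComponents_eq hG, modelChristoffel, coord02_self]
  rfl

/-- Links the Christoffel symbols in the chart preferred at x with those in the chart at x₀. The
components in the first chart are the pullback of those in the second by the transition map, so
`modelChristoffel_transform` applies. -/
theorem modelChristoffel_coord02_transition {G : Tensor02 I M}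
    (hG : ∀ x, (raw02 G x).IsInvertible)
    (hs : ∀ (x : M) (v w : TangentSpace I x), G x v w = G x w v)
    (hd : ∀ (x : M), ∀ z ∈ (extChartAt I x).target, DifferentiableAt ℝ (coord02 G x) z)
    {x x₀ : M} (hx : x ∈ (extChartAt I x₀).source) (v w : E) :
    modelChristoffel (coord02 G x₀) (extChartAt I x₀ x) (tangentCoordChange I x x₀ x v)
        (tangentCoordChange I x x₀ x w) +
      fderiv ℝ (fderiv ℝ (transition I x x₀)) (extChartAt I x x) v w =
    tangentCoordChange I x x₀ x (christoffel G x v w) := by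
  have ht := mem_extChartAt_target (I := I) x
  have hψ : transition I x x₀ (extChartAt I x x) = extChartAt I x₀ x := by
    simp only [transition, Function.comp_apply, extChartAt_to_inv]
  have ht₀ : extChartAt I x₀ x ∈ (extChartAt I x₀).target := (extChartAt I x₀).map_source hx
  have hD : fderiv ℝ (transition I x x₀) (extChartAt I x x) = tangentCoordChange I x x₀ x := by
    rw [fderiv_transition x x₀ ht, extChartAt_to_inv]
  rw [christoffel_eq_modelChristoffel (hd x _ ht), ← hD, ← hψ]
  apply modelChristoffel_transform
  · exact isInvertible_coord02 hG x ht
  · rw [hψ]; exact isInvertible_coord02 hG x₀ ht₀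
  · exact fun v w ↦ hs _ _ _
  · rw [hψ]; exact hd x₀ _ ht₀
  · exact hd x _ ht
  · exact (contDiffAt_transition hx).of_le ENat.LEInfty.out
  · rw [hD]; exact isInvertible_tangentCoordChange (mem_extChartAt_source x) hx
  · filter_upwards [eventually_mem_target_and_symm_mem_source hx] with z hz
    exact coord02_transition G hz.1 hz.2

/-- The derivative of the inverse Jacobian of a transition map. -/
theorem hasFDerivAt_tangentCoordChange_symm [CompleteSpace E] {x x₀ : M}
    (hx : x ∈ (extChartAt I x₀).source) :
    ∃ D : E →L[ℝ] E →L[ℝ] E,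
      HasFDerivAt (fun z ↦ tangentCoordChange I x₀ x ((extChartAt I x).symm z)) D
        (extChartAt I x x) ∧
      ∀ v w, D v (tangentCoordChange I x x₀ x w) = - tangentCoordChange I x₀ x x
        (fderiv ℝ (fderiv ℝ (transition I x x₀)) (extChartAt I x x) v w) := by
  have hT : ContDiffAt ℝ 1 (fderiv ℝ (transition I x x₀)) (extChartAt I x x) :=
    ((contDiffAt_transition hx).fderiv_right (m := ∞) (by simp)).of_le (by simp)
  have hD : fderiv ℝ (transition I x x₀) (extChartAt I x x) = tangentCoordChange I x x₀ x := by
    rw [fderiv_transition x x₀ (mem_extChartAt_target x), extChartAt_to_inv]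
  have hd : DifferentiableAt ℝ (fun z ↦ tangentCoordChange I x₀ x ((extChartAt I x).symm z))
      (extChartAt I x x) := by
    -- Near the centre the map is the pointwise inverse of the Jacobian of the transition map, and
    -- inversion is smooth at an invertible operator.
    obtain ⟨e, he⟩ := isInvertible_tangentCoordChange (I := I) (mem_extChartAt_source x) hx
    have h1 : ContDiffAt ℝ 1 (fun z ↦ (fderiv ℝ (transition I x x₀) z).inverse)
        (extChartAt I x x) := by
      refine ContDiffAt.comp (g := ContinuousLinearMap.inverse) _ ?_ hT
      rw [hD, ← he]
      exact contDiffAt_map_inverse e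
    refine (h1.differentiableAt one_ne_zero).congr_of_eventuallyEq ?_
    filter_upwards [eventually_mem_target_and_symm_mem_source hx] with z hz
    rw [fderiv_transition x x₀ hz.1]
    have hy := (extChartAt I x).map_target hz.1
    symm
    apply ContinuousLinearMap.inverse_eq
    · ext v
      exact (tangentCoordChange_comp ⟨⟨hz.2, hy⟩, hz.2⟩).trans (tangentCoordChange_self hz.2)
    · ext v
      exact (tangentCoordChange_comp ⟨⟨hy, hz.2⟩, hy⟩).trans (tangentCoordChange_self hy)
  refine ⟨_, hd.hasFDerivAt, fun v w ↦ ?_⟩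
  have h2 := hd.hasFDerivAt.clm_apply ((hT.differentiableAt one_ne_zero).hasFDerivAt.clm_apply
    (hasFDerivAt_const w _))
  -- Inverse Jacobian times Jacobian fixes w near the centre, so the product rule for this constant
  -- determines D on the image of the Jacobian.
  have h3 := h2.congr_of_eventuallyEq (f₁ := fun _ ↦ w) (by
    filter_upwards [eventually_mem_target_and_symm_mem_source hx] with z hz
    have hy := (extChartAt I x).map_target hz.1
    rw [fderiv_transition x x₀ hz.1]
    exact ((tangentCoordChange_comp ⟨⟨hy, hz.2⟩, hy⟩).trans (tangentCoordChange_self hy)).symm)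
  have h4 := congrArg (fun l : E →L[ℝ] E ↦ l v) (h3.unique (hasFDerivAt_const w _))
  simp only [add_apply, ContinuousLinearMap.comp_apply, ContinuousLinearMap.flip_apply, map_zero,
    zero_apply, zero_add, extChartAt_to_inv, hD] at h4
  rw [add_comm] at h4
  exact eq_neg_of_add_eq_zero_left h4

end CoordChange

end ManifoldTensor

namespace Cotangent

open ManifoldTensor

/-! ### Charts of the cotangent bundle and their transition maps -/

section Chart

variable {E : Type*} [NormedAddCommGroup E] [NormedSpace ℝ E]
  {M : Type*} [TopologicalSpace M] [ChartedSpace E M] [IsManifold 𝓘(ℝ, E) ∞ M]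

/-- The components of a covector in the preferred chart at its base point. -/
def rawCovector (p : CotangentBundle E M) : E →L[ℝ] ℝ := p.2

theorem extChartAt_cotangent_apply (p₀ p : CotangentBundle E M)
    (hp : p.1 ∈ (extChartAt 𝓘(ℝ, E) p₀.1).source) :
    extChartAt (cotangentModel E) p₀ p = (extChartAt 𝓘(ℝ, E) p₀.1 p.1,
      (rawCovector p).comp (tangentCoordChange 𝓘(ℝ, E) p₀.1 p.1 p.1)) := by
  have h := symmL_eq_tangentCoordChange hp
  rw [FiberBundle.extChartAt, ← h]
  refine Prod.ext rfl ?_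
  simp only [PartialEquiv.coe_trans, Function.comp_apply, PartialEquiv.prod_coe,
    PartialEquiv.refl_coe, id_eq]
  change (trivializationAt (E →L[ℝ] ℝ) (fun x : M ↦ TangentSpace 𝓘(ℝ, E) x →L[ℝ] ℝ) p₀.1 p).2 = _
  rw [hom_trivializationAt_apply]
  simp only [ContinuousLinearMap.inCoordinates]
  ext v
  simp
  rfl

theorem mem_extChartAt_cotangent_source {p₀ p : CotangentBundle E M} :
    p ∈ (extChartAt (cotangentModel E) p₀).source ↔
      p.1 ∈ (extChartAt 𝓘(ℝ, E) p₀.1).source := by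
  rw [extChartAt_source, extChartAt_source, FiberBundle.chartedSpace_chartAt]
  simp only [mfld_simps]
  exact ⟨fun h ↦ h.1.1, fun h ↦ ⟨⟨h, trivial⟩, h⟩⟩

theorem extChartAt_cotangent_symm_proj {p₀ : CotangentBundle E M} {z : E × (E →L[ℝ] ℝ)}
    (hz : z ∈ (extChartAt (cotangentModel E) p₀).target) :
    ((extChartAt (cotangentModel E) p₀).symm z).1 = (extChartAt 𝓘(ℝ, E) p₀.1).symm z.1 := by
  set p := (extChartAt (cotangentModel E) p₀).symm z with hp
  have h1 := mem_extChartAt_cotangent_source.1 ((extChartAt (cotangentModel E) p₀).map_target hz)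
  have h2 := extChartAt_cotangent_apply p₀ p h1
  rw [hp, (extChartAt (cotangentModel E) p₀).right_inv hz] at h2
  rw [h2]
  exact ((extChartAt 𝓘(ℝ, E) p₀.1).left_inv h1).symm

end Chart

end Cotangent

namespace Cotangent

open ManifoldTensor

section Transition

variable {E : Type*} [NormedAddCommGroup E] [NormedSpace ℝ E]
  {M : Type*} [TopologicalSpace M] [ChartedSpace E M] [IsManifold 𝓘(ℝ, E) ∞ M]

/-- Covectors transform by precomposition with the inverse Jacobian of the base transition,
evaluated at the moving base point; its derivative therefore enters the Jacobian on T*M. -/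
theorem transition_cotangent {p p₀ : CotangentBundle E M} {z : E × (E →L[ℝ] ℝ)}
    (hz : z ∈ (extChartAt (cotangentModel E) p).target)
    (hz₀ : (extChartAt (cotangentModel E) p).symm z ∈ (extChartAt (cotangentModel E) p₀).source) :
    transition (cotangentModel E) p p₀ z = (transition 𝓘(ℝ, E) p.1 p₀.1 z.1,
      z.2.comp (tangentCoordChange 𝓘(ℝ, E) p₀.1 p.1 ((extChartAt 𝓘(ℝ, E) p.1).symm z.1))) := by
  have hy := extChartAt_cotangent_symm_proj hz
  have h := mem_extChartAt_cotangent_source.1 ((extChartAt (cotangentModel E) p).map_target hz)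
  have h₀ := mem_extChartAt_cotangent_source.1 hz₀
  have e := extChartAt_cotangent_apply p _ h
  rw [(extChartAt (cotangentModel E) p).right_inv hz] at e
  rw [transition, Function.comp_apply, extChartAt_cotangent_apply p₀ _ h₀, transition,
    Function.comp_apply, ← hy]
  have e₂ : z.2 = _ := congrArg Prod.snd e
  refine Prod.ext rfl (ContinuousLinearMap.ext fun v ↦ ?_)
  simp only [ContinuousLinearMap.comp_apply]
  rw [e₂, ContinuousLinearMap.comp_apply, tangentCoordChange_comp ⟨⟨h₀, h⟩, mem_extChartAt_source _⟩]

/-- The Jacobian of the transition maps of the cotangent bundle. -/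
theorem tangentCoordChange_cotangent [CompleteSpace E] {p p₀ : CotangentBundle E M}
    (hp : p ∈ (extChartAt (cotangentModel E) p₀).source) :
    ∃ D : E →L[ℝ] E →L[ℝ] E,
      (∀ v w, D v (tangentCoordChange 𝓘(ℝ, E) p.1 p₀.1 p.1 w) =
        - tangentCoordChange 𝓘(ℝ, E) p₀.1 p.1 p.1
        (fderiv ℝ (fderiv ℝ (transition 𝓘(ℝ, E) p.1 p₀.1)) (extChartAt 𝓘(ℝ, E) p.1 p.1) v w)) ∧
      ∀ ξ : E × (E →L[ℝ] ℝ), tangentCoordChange (cotangentModel E) p p₀ p ξ =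
        (tangentCoordChange 𝓘(ℝ, E) p.1 p₀.1 p.1 ξ.1,
          ξ.2.comp (tangentCoordChange 𝓘(ℝ, E) p₀.1 p.1 p.1) + (rawCovector p).comp (D ξ.1)) := by
  have hx := mem_extChartAt_cotangent_source.1 hp
  obtain ⟨D, hD, hD'⟩ := hasFDerivAt_tangentCoordChange_symm hx
  refine ⟨D, hD', fun ξ ↦ ?_⟩
  have hz : extChartAt (cotangentModel E) p p =
      (extChartAt 𝓘(ℝ, E) p.1 p.1, rawCovector p) := by
    rw [extChartAt_cotangent_apply p p (mem_extChartAt_source p.1), tangentCoordChange_diag]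
    rfl
  have hψ := ((contDiffAt_transition hx).differentiableAt (by simp)).hasFDerivAt
  rw [fderiv_transition _ _ (mem_extChartAt_target p.1), extChartAt_to_inv] at hψ
  have h1 : HasFDerivAt (fun z : E × (E →L[ℝ] ℝ) ↦ (transition 𝓘(ℝ, E) p.1 p₀.1 z.1,
      z.2.comp (tangentCoordChange 𝓘(ℝ, E) p₀.1 p.1 ((extChartAt 𝓘(ℝ, E) p.1).symm z.1)))) _
      (extChartAt 𝓘(ℝ, E) p.1 p.1, rawCovector p) :=
    (HasFDerivAt.comp (𝕜 := ℝ) (f := Prod.fst)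
      (extChartAt 𝓘(ℝ, E) p.1 p.1, rawCovector p) hψ hasFDerivAt_fst).prodMk
      (hasFDerivAt_snd.clm_comp (HasFDerivAt.comp (𝕜 := ℝ) (f := Prod.fst)
        (extChartAt 𝓘(ℝ, E) p.1 p.1, rawCovector p) hD hasFDerivAt_fst))
  rw [← hz] at h1
  have h2 := h1.congr_of_eventuallyEq (f₁ := transition (cotangentModel E) p p₀) (by
    filter_upwards [eventually_mem_target_and_symm_mem_source hp] with z hz
    exact transition_cotangent hz.1 hz.2)
  have h3 := h2.fderiv
  rw [fderiv_transition _ _ (mem_extChartAt_target p), extChartAt_to_inv] at h3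
  rw [h3, hz, extChartAt_to_inv]
  exact Prod.ext rfl (add_comm _ _)

end Transition

/-! ### Chart independence of the vertical part, of J and of the metric -/

section Invariance

variable {E : Type*} [NormedAddCommGroup E] [NormedSpace ℝ E]
  {M : Type*} [TopologicalSpace M] [ChartedSpace E M] [IsManifold 𝓘(ℝ, E) ∞ M]
  {g : Tensor02 𝓘(ℝ, E) M}

/-- The vertical part in the preferred charts. -/
def rawVPart (g : Tensor02 𝓘(ℝ, E) M) (p : CotangentBundle E M) :
    E × (E →L[ℝ] ℝ) →L[ℝ] (E →L[ℝ] ℝ) := vPart g p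

theorem rawVPart_apply (p : CotangentBundle E M) (ξ : E × (E →L[ℝ] ℝ)) (w : E) :
    rawVPart g p ξ w = ξ.2 w - rawCovector p (christoffel g p.1 ξ.1 w) := rfl

theorem raw11_J_apply (p : CotangentBundle E M) (ξ : E × (E →L[ℝ] ℝ)) :
    (raw11 (J g) p ξ).1 = -ξ.1 ∧ rawVPart g p (raw11 (J g) p ξ) = rawVPart g p ξ := by
  have h1 : (raw11 (J g) p ξ).1 = 0 - ξ.1 := rfl
  have h2 : (raw11 (J g) p ξ).2 = rawVPart g p ξ - connForm g p ξ.1 := rfl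
  refine ⟨by rw [h1, zero_sub], ?_⟩
  ext w
  have h3 : connForm g p ξ.1 w = rawCovector p (christoffel g p.1 ξ.1 w) := rfl
  rw [rawVPart_apply, h1, h2, zero_sub, sub_apply, h3]
  simp

theorem fst_tangentCoordChange_cotangent [CompleteSpace E] {p p₀ : CotangentBundle E M}
    (hp : p ∈ (extChartAt (cotangentModel E) p₀).source) (ξ : E × (E →L[ℝ] ℝ)) :
    (tangentCoordChange (cotangentModel E) p p₀ p ξ).1 =
      tangentCoordChange 𝓘(ℝ, E) p.1 p₀.1 p.1 ξ.1 := by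
  obtain ⟨D, -, h⟩ := tangentCoordChange_cotangent hp
  rw [h]

/-- The vertical part does not depend on the chart. -/
theorem modelVPart_tangentCoordChange [CompleteSpace E]
    (hg : ∀ x, (raw02 g x).IsInvertible)
    (hs : ∀ (x : M) (v w : TangentSpace 𝓘(ℝ, E) x), g x v w = g x w v)
    (hd : ∀ (x : M), ∀ z ∈ (extChartAt 𝓘(ℝ, E) x).target, DifferentiableAt ℝ (coord02 g x) z)
    {p p₀ : CotangentBundle E M} (hp : p ∈ (extChartAt (cotangentModel E) p₀).source)
    (ξ : E × (E →L[ℝ] ℝ)) :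
    modelVPart (coord02 g p₀.1) (extChartAt (cotangentModel E) p₀ p)
      (tangentCoordChange (cotangentModel E) p p₀ p ξ) =
    (rawVPart g p ξ).comp (tangentCoordChange 𝓘(ℝ, E) p₀.1 p.1 p.1) := by
  have hx := mem_extChartAt_cotangent_source.1 hp
  obtain ⟨D, hD, h⟩ := tangentCoordChange_cotangent hp
  rw [h, extChartAt_cotangent_apply p₀ p hx, modelVPart_apply]
  ext w'
  obtain ⟨w, rfl⟩ : ∃ w, tangentCoordChange 𝓘(ℝ, E) p.1 p₀.1 p.1 w = w' :=
    ⟨_, tangentCoordChange_symm_comp hx w'⟩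
  -- The transformation law, pulled back by the inverse Jacobian, contributes p applied to the
  -- pulled-back second derivative of the transition; the term p ∘ D of the cotangent Jacobian is
  -- its negative by `hD`.
  have key := modelChristoffel_coord02_transition hg hs hd hx ξ.1 w
  have key' := congrArg (tangentCoordChange 𝓘(ℝ, E) p₀.1 p.1 p.1) key
  rw [map_add, tangentCoordChange_comp_symm hx] at key'
  have e : modelConn (coord02 g p₀.1) (extChartAt 𝓘(ℝ, E) p₀.1 p.1,
      (rawCovector p).comp (tangentCoordChange 𝓘(ℝ, E) p₀.1 p.1 p.1))
      (tangentCoordChange 𝓘(ℝ, E) p.1 p₀.1 p.1 ξ.1) (tangentCoordChange 𝓘(ℝ, E) p.1 p₀.1 p.1 w) =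
      rawCovector p (tangentCoordChange 𝓘(ℝ, E) p₀.1 p.1 p.1
        (modelChristoffel (coord02 g p₀.1) (extChartAt 𝓘(ℝ, E) p₀.1 p.1)
          (tangentCoordChange 𝓘(ℝ, E) p.1 p₀.1 p.1 ξ.1)
          (tangentCoordChange 𝓘(ℝ, E) p.1 p₀.1 p.1 w))) := rfl
  simp only [sub_apply, add_apply, ContinuousLinearMap.comp_apply]
  rw [tangentCoordChange_comp_symm hx, e, rawVPart_apply, hD, ← key']
  simp only [map_add, map_neg]
  ring

/-- In a chart, `J` is given by the coordinate formula. -/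
theorem coord11_J [CompleteSpace E]
    (hg : ∀ x, (raw02 g x).IsInvertible)
    (hs : ∀ (x : M) (v w : TangentSpace 𝓘(ℝ, E) x), g x v w = g x w v)
    (hd : ∀ (x : M), ∀ z ∈ (extChartAt 𝓘(ℝ, E) x).target, DifferentiableAt ℝ (coord02 g x) z)
    {p₀ : CotangentBundle E M} {z : E × (E →L[ℝ] ℝ)}
    (hz : z ∈ (extChartAt (cotangentModel E) p₀).target) :
    coord11 (J g) p₀ z = modelJ (coord02 g p₀.1) z := by
  set p := (extChartAt (cotangentModel E) p₀).symm z with hpz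
  have hp : p ∈ (extChartAt (cotangentModel E) p₀).source :=
    (extChartAt (cotangentModel E) p₀).map_target hz
  have hzp : extChartAt (cotangentModel E) p₀ p = z :=
    (extChartAt (cotangentModel E) p₀).right_inv hz
  refine ContinuousLinearMap.ext fun ξ' ↦ ?_
  -- Coordinate changes are onto, so the argument may be taken as the image of a vector written in
  -- the chart preferred at p, where J is defined.
  obtain ⟨ξ, rfl⟩ : ∃ ξ, tangentCoordChange (cotangentModel E) p p₀ p ξ = ξ' :=
    ⟨_, tangentCoordChange_symm_comp hp ξ'⟩
  rw [coord11, ContinuousLinearMap.comp_apply, ContinuousLinearMap.comp_apply, ← hpz,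
    tangentCoordChange_comp_symm hp]
  have h1 : (tangentCoordChange (cotangentModel E) p p₀ p (raw11 (J g) p ξ)).1 =
      (modelJ (coord02 g p₀.1) z (tangentCoordChange (cotangentModel E) p p₀ p ξ)).1 := by
    rw [modelJ_apply, fst_tangentCoordChange_cotangent hp, fst_tangentCoordChange_cotangent hp,
      (raw11_J_apply p ξ).1, map_neg]
  have h2 := modelVPart_tangentCoordChange hg hs hd hp (raw11 (J g) p ξ)
  rw [(raw11_J_apply p ξ).2, ← modelVPart_tangentCoordChange hg hs hd hp ξ, hzp,
    ← modelVPart_modelJ _ _ (tangentCoordChange (cotangentModel E) p p₀ p ξ), modelVPart_apply, modelVPart_apply, h1] at h2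
  -- A vector is determined by its base component and its vertical part: once the base components
  -- agree, so do the N terms subtracted in `h2`.
  exact Prod.ext h1 (sub_left_injective h2)

/-- Raising an index commutes with coordinate changes: the vector dual to the transformed covector
is the transformed dual vector. -/
theorem modelCoInner_coord02 (hg : ∀ x, (raw02 g x).IsInvertible)
    {x x₀ : M} (hx : x ∈ (extChartAt 𝓘(ℝ, E) x₀).source) (a b : E →L[ℝ] ℝ) :
    modelCoInner (coord02 g x₀) (extChartAt 𝓘(ℝ, E) x₀ x)
      (a.comp (tangentCoordChange 𝓘(ℝ, E) x₀ x x)) (b.comp (tangentCoordChange 𝓘(ℝ, E) x₀ x x)) =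
    raw02 g x ((raw02 g x).inverse a) ((raw02 g x).inverse b) := by
  have hI := isInvertible_coord02 hg x₀ ((extChartAt 𝓘(ℝ, E) x₀).map_source hx)
  have e : (coord02 g x₀ (extChartAt 𝓘(ℝ, E) x₀ x)).inverse
      (b.comp (tangentCoordChange 𝓘(ℝ, E) x₀ x x)) =
      tangentCoordChange 𝓘(ℝ, E) x x₀ x ((raw02 g x).inverse b) := by
    have : b.comp (tangentCoordChange 𝓘(ℝ, E) x₀ x x) = coord02 g x₀ (extChartAt 𝓘(ℝ, E) x₀ x)
        (tangentCoordChange 𝓘(ℝ, E) x x₀ x ((raw02 g x).inverse b)) := by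
      ext w
      rw [coord02, (extChartAt 𝓘(ℝ, E) x₀).left_inv hx, pullbackForm_apply,
        tangentCoordChange_comp_symm hx, apply_inverse_of_isInvertible (hg x)]
      rfl
    rw [this, inverse_apply_of_isInvertible hI]
  rw [modelCoInner_apply hI, e, ContinuousLinearMap.comp_apply, tangentCoordChange_comp_symm hx,
    apply_inverse_of_isInvertible (hg x)]

/-- In a chart, the rescaled metric of Cheeger-Gromoll type is given by the coordinate formula. -/
theorem coord02_cgMetric [CompleteSpace E]
    (hg : ∀ x, (raw02 g x).IsInvertible)
    (hs : ∀ (x : M) (v w : TangentSpace 𝓘(ℝ, E) x), g x v w = g x w v)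
    (hd : ∀ (x : M), ∀ z ∈ (extChartAt 𝓘(ℝ, E) x).target, DifferentiableAt ℝ (coord02 g x) z)
    (f : M → ℝ) {p₀ : CotangentBundle E M} {z : E × (E →L[ℝ] ℝ)}
    (hz : z ∈ (extChartAt (cotangentModel E) p₀).target) :
    coord02 (cgMetric g f) p₀ z =
      modelMetric (coord02 g p₀.1) (f ∘ (extChartAt 𝓘(ℝ, E) p₀.1).symm) z := by
  set p := (extChartAt (cotangentModel E) p₀).symm z with hpz
  have hp : p ∈ (extChartAt (cotangentModel E) p₀).source :=
    (extChartAt (cotangentModel E) p₀).map_target hz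
  have hx := mem_extChartAt_cotangent_source.1 hp
  have hzp : extChartAt (cotangentModel E) p₀ p = z :=
    (extChartAt (cotangentModel E) p₀).right_inv hz
  refine ContinuousLinearMap.ext fun ξ' ↦ ContinuousLinearMap.ext fun ζ' ↦ ?_
  obtain ⟨ξ, rfl⟩ : ∃ ξ, tangentCoordChange (cotangentModel E) p p₀ p ξ = ξ' :=
    ⟨_, tangentCoordChange_symm_comp hp ξ'⟩
  obtain ⟨ζ, rfl⟩ : ∃ ζ, tangentCoordChange (cotangentModel E) p p₀ p ζ = ζ' :=
    ⟨_, tangentCoordChange_symm_comp hp ζ'⟩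
  have hz' := extChartAt_cotangent_apply p₀ p hx
  rw [hzp] at hz'
  rw [coord02, pullbackForm_apply, ← hpz, tangentCoordChange_comp_symm hp,
    tangentCoordChange_comp_symm hp, modelMetric_apply, fst_tangentCoordChange_cotangent hp,
    fst_tangentCoordChange_cotangent hp]
  have hξ := modelVPart_tangentCoordChange hg hs hd hp ξ
  have hζ := modelVPart_tangentCoordChange hg hs hd hp ζ
  rw [hzp] at hξ hζ
  rw [hξ, hζ, modelVert_apply, hz']
  simp only [Function.comp_apply]
  rw [(extChartAt 𝓘(ℝ, E) p₀.1).left_inv hx, modelCoInner_coord02 hg hx,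
    modelCoInner_coord02 hg hx, modelCoInner_coord02 hg hx, modelCoInner_coord02 hg hx,
    coord02, (extChartAt 𝓘(ℝ, E) p₀.1).left_inv hx, pullbackForm_apply,
    tangentCoordChange_comp_symm hx, tangentCoordChange_comp_symm hx]
  rfl

end Invariance

end Cotangent

namespace ManifoldTensor

/-! ### Positive definite forms in finite dimension -/

section PositiveDefinite

variable {V : Type*} [NormedAddCommGroup V] [NormedSpace ℝ V] [FiniteDimensional ℝ V]
  {B : V →L[ℝ] V →L[ℝ] ℝ}

/-- Positivity makes v ↦ B(v, ·) injective, and V and its dual have the same dimension. -/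
theorem isInvertible_of_pos (hB : ∀ v, v ≠ 0 → 0 < B v v) : B.IsInvertible := by
  have hinj : Function.Injective (B : V →ₗ[ℝ] (V →L[ℝ] ℝ)) := by
    rw [← LinearMap.ker_eq_bot, LinearMap.ker_eq_bot']
    intro v hv
    by_contra hne
    have h : B v = 0 := hv
    exact (hB v hne).ne' (by rw [h]; rfl)
  have hrank : Module.finrank ℝ V = Module.finrank ℝ (V →L[ℝ] ℝ) := by
    rw [← (LinearMap.toContinuousLinearMap (𝕜 := ℝ) (E := V) (F' := ℝ)).finrank_eq]
    exact (Subspace.dual_finrank_eq (K := ℝ) (V := V)).symm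
  let e := LinearEquiv.ofInjectiveOfFinrankEq (B : V →ₗ[ℝ] (V →L[ℝ] ℝ)) hinj hrank
  exact ⟨e.toContinuousLinearEquiv, rfl⟩

theorem isVonNBounded_of_pos (hB : ∀ v, v ≠ 0 → 0 < B v v) :
    Bornology.IsVonNBounded ℝ {v : V | B v v < 1} := by
  rw [NormedSpace.isVonNBounded_iff]
  -- The unit sphere is empty only when V is zero. Otherwise B attains a positive minimum c on it by
  -- compactness, and B(v,v) ≥ c‖v‖² bounds the unit ball of B.
  rcases (Metric.sphere (0 : V) 1).eq_empty_or_nonempty with he | hne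
  · refine (Bornology.isBounded_singleton (x := (0 : V))).subset fun v _ ↦ ?_
    by_contra hv
    have : ‖v‖⁻¹ • v ∈ Metric.sphere (0 : V) 1 := by
      rw [mem_sphere_zero_iff_norm, norm_smul, norm_inv, norm_norm,
        inv_mul_cancel₀ (norm_ne_zero_iff.2 hv)]
    simp [he] at this
  · have hc : Continuous fun v ↦ B v v := by fun_prop
    obtain ⟨u, hu, hmin⟩ := (isCompact_sphere (0 : V) 1).exists_isMinOn hne hc.continuousOn
    have hu0 : u ≠ 0 := fun h ↦ by simp [h] at hu
    have hpos := hB u hu0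
    have hle (v : V) : B u u * ‖v‖ ^ 2 ≤ B v v := by
      rcases eq_or_ne v 0 with rfl | hv
      · simp
      · have hs : ‖v‖⁻¹ • v ∈ Metric.sphere (0 : V) 1 := by
          rw [mem_sphere_zero_iff_norm, norm_smul, norm_inv, norm_norm,
            inv_mul_cancel₀ (norm_ne_zero_iff.2 hv)]
        have h : B u u ≤ B (‖v‖⁻¹ • v) (‖v‖⁻¹ • v) := hmin hs
        simp only [map_smul, smul_apply, smul_eq_mul] at h
        have hv' : ‖v‖ ≠ 0 := norm_ne_zero_iff.2 hv
        calc B u u * ‖v‖ ^ 2 ≤ (‖v‖⁻¹ * (‖v‖⁻¹ * B v v)) * ‖v‖ ^ 2 := by gcongr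
          _ = B v v := by field_simp
    refine (Metric.isBounded_closedBall (x := (0 : V)) (r := √(B u u)⁻¹)).subset fun v hv ↦ ?_
    rw [mem_closedBall_zero_iff]
    apply Real.le_sqrt_of_sq_le
    rw [← one_div, le_div_iff₀ hpos, mul_comm]
    exact (hle v).trans (le_of_lt hv)

end PositiveDefinite

end ManifoldTensor

/-! ### Paracomplex structure, Riemannian metric and cyclic identity on the cotangent bundle -/

namespace Cotangent

open ManifoldTensor

theorem eq_zero_of_eq_neg {V : Type*} [AddCommGroup V] [Module ℝ V] {v : V} (h : v = -v) :
    v = 0 := by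
  have h2 : (2 : ℝ) • v = 0 := by rw [two_smul, ← eq_neg_iff_add_eq_zero, ← h]
  exact (smul_eq_zero.1 h2).resolve_left two_ne_zero

theorem modelVert_symm {E : Type*} [NormedAddCommGroup E] [NormedSpace ℝ E]
    {g : E → E →L[ℝ] E →L[ℝ] ℝ} {z : E × (E →L[ℝ] ℝ)} (hs : ∀ v w, g z.1 v w = g z.1 w v)
    (a b : E →L[ℝ] ℝ) : modelVert g z a b = modelVert g z b a := by
  have h : modelCoInner g z.1 a b = modelCoInner g z.1 b a := hs _ _
  rw [modelVert_apply, modelVert_apply, h, mul_comm (modelCoInner g z.1 a z.2)]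

section Main

variable {E : Type*} [NormedAddCommGroup E] [NormedSpace ℝ E] [FiniteDimensional ℝ E]
  {M : Type*} [TopologicalSpace M] [ChartedSpace E M] [IsManifold 𝓘(ℝ, E) ∞ M]
  (g : ContMDiffRiemannianMetric 𝓘(ℝ, E) ∞ E (fun x : M ↦ TangentSpace 𝓘(ℝ, E) x))
  {f : M → ℝ}

omit [FiniteDimensional ℝ E] in
theorem hPart_J (h : Tensor02 𝓘(ℝ, E) M) (p : CotangentBundle E M)
    (ξ : TangentSpace (cotangentModel E) p) : hPart p (J h p ξ) = - hPart p ξ := by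
  simp [J]

omit [FiniteDimensional ℝ E] in
theorem vPart_J (h : Tensor02 𝓘(ℝ, E) M) (p : CotangentBundle E M)
    (ξ : TangentSpace (cotangentModel E) p) : vPart h p (J h p ξ) = vPart h p ξ := by
  simp [J]

omit [FiniteDimensional ℝ E] in
theorem J_apply (h : Tensor02 𝓘(ℝ, E) M) (p : CotangentBundle E M)
    (ξ : TangentSpace (cotangentModel E) p) :
    J h p ξ = vLift p (vPart h p ξ) - hLift h p (hPart p ξ) := rfl

omit [FiniteDimensional ℝ E] in
theorem J_J (h : Tensor02 𝓘(ℝ, E) M) (p : CotangentBundle E M)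
    (ξ : TangentSpace (cotangentModel E) p) : J h p (J h p ξ) = ξ := by
  rw [J_apply h p (J h p ξ), vPart_J, hPart_J, map_neg, sub_neg_eq_add, add_comm]
  exact hLift_add_vLift h p ξ

theorem isInvertible_raw02 (x : M) : (raw02 (I := 𝓘(ℝ, E)) g.inner x).IsInvertible :=
  isInvertible_of_pos (g.pos x)

omit [FiniteDimensional ℝ E] in
theorem coInner_symm (x : M) (a b : TangentSpace 𝓘(ℝ, E) x →L[ℝ] ℝ) :
    coInner g.inner x a b = coInner g.inner x b a := g.symm x _ _

omit [FiniteDimensional ℝ E] in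
theorem coInner_self_nonneg (x : M) (a : TangentSpace 𝓘(ℝ, E) x →L[ℝ] ℝ) :
    0 ≤ coInner g.inner x a a := by
  by_cases h : sharp g.inner x a = 0
  · have : coInner g.inner x a a = g.inner x (sharp g.inner x a) (sharp g.inner x a) := rfl
    rw [this, h]
    simp
  · exact (g.pos x _ h).le

theorem coInner_self_pos (x : M) {a : TangentSpace 𝓘(ℝ, E) x →L[ℝ] ℝ} (ha : a ≠ 0) :
    0 < coInner g.inner x a a := by
  refine g.pos x (sharp g.inner x a) fun h ↦ ha ?_
  have h1 : raw02 (I := 𝓘(ℝ, E)) g.inner x ((raw02 (I := 𝓘(ℝ, E)) g.inner x).inverse a) = a :=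
    apply_inverse_of_isInvertible (isInvertible_raw02 g x) a
  have h2 : (raw02 (I := 𝓘(ℝ, E)) g.inner x).inverse a = 0 := h
  rw [h2, map_zero] at h1
  exact h1.symm

omit [FiniteDimensional ℝ E] in
theorem alpha_pos (p : CotangentBundle E M) : 0 < alpha g.inner p :=
  add_pos_of_pos_of_nonneg one_pos (coInner_self_nonneg g p.1 p.2)

omit [FiniteDimensional ℝ E] in
theorem vertMetric_apply (p : CotangentBundle E M) (a b : TangentSpace 𝓘(ℝ, E) p.1 →L[ℝ] ℝ) :
    vertMetric g.inner p a b = 1 / alpha g.inner p *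
      (coInner g.inner p.1 a b + coInner g.inner p.1 a p.2 * coInner g.inner p.1 b p.2) := rfl

omit [FiniteDimensional ℝ E] in
theorem vertMetric_symm (p : CotangentBundle E M) (a b : TangentSpace 𝓘(ℝ, E) p.1 →L[ℝ] ℝ) :
    vertMetric g.inner p a b = vertMetric g.inner p b a := by
  rw [vertMetric_apply, vertMetric_apply, coInner_symm g p.1 a b, mul_comm (coInner _ _ a p.2)]

theorem vertMetric_self_pos (p : CotangentBundle E M) {a : TangentSpace 𝓘(ℝ, E) p.1 →L[ℝ] ℝ}
    (ha : a ≠ 0) : 0 < vertMetric g.inner p a a := by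
  rw [vertMetric_apply]
  exact mul_pos (one_div_pos.2 (alpha_pos g p))
    (add_pos_of_pos_of_nonneg (coInner_self_pos g p.1 ha) (mul_self_nonneg _))

omit [FiniteDimensional ℝ E] in
theorem cgMetric_symm (p : CotangentBundle E M) (ξ ζ : TangentSpace (cotangentModel E) p) :
    cgMetric g.inner f p ξ ζ = cgMetric g.inner f p ζ ξ := by
  rw [cgMetric_apply, cgMetric_apply, vertMetric_symm, g.symm p.1 (hPart p ξ)]

theorem cgMetric_self_pos (hf : ∀ x, 0 < f x) (p : CotangentBundle E M)
    (ξ : TangentSpace (cotangentModel E) p) (hξ : ξ ≠ 0) : 0 < cgMetric g.inner f p ξ ξ := by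
  rw [cgMetric_apply]
  by_cases h : hPart p ξ = 0
  · have h2 : vPart g.inner p ξ ≠ 0 := fun h2 ↦ hξ (by
      rw [← hLift_add_vLift g.inner p ξ, h, h2, map_zero, map_zero, add_zero])
    have := vertMetric_self_pos g p h2
    rw [h, map_zero, mul_zero]
    linarith
  · have h1 := mul_pos (hf p.1) (g.pos p.1 _ h)
    by_cases h2 : vPart g.inner p ξ = 0
    · rw [h2, map_zero]
      simpa using h1
    · exact add_pos h1 (vertMetric_self_pos g p h2)

omit [FiniteDimensional ℝ E] in
theorem cgMetric_pure (p : CotangentBundle E M) (ξ ζ : TangentSpace (cotangentModel E) p) :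
    cgMetric g.inner f p (J g.inner p ξ) ζ = cgMetric g.inner f p ξ (J g.inner p ζ) := by
  rw [cgMetric_apply, cgMetric_apply, hPart_J, hPart_J, vPart_J, vPart_J]
  simp

theorem isInvertible_raw02_cgMetric (hf : ∀ x, 0 < f x) (p : CotangentBundle E M) :
    (raw02 (cgMetric g.inner f) p).IsInvertible :=
  isInvertible_of_pos (cgMetric_self_pos g hf p)

omit [FiniteDimensional ℝ E] in
theorem contDiffAt_coord02_inner (x : M) {z : E} (hz : z ∈ (extChartAt 𝓘(ℝ, E) x).target) :
    ContDiffAt ℝ ∞ (coord02 (I := 𝓘(ℝ, E)) g.inner x) z :=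
  contDiffAt_coord02 g.contMDiff x hz

theorem coord11_J_eventuallyEq (p : CotangentBundle E M) :
    coord11 (J g.inner) p =ᶠ[𝓝 (extChartAt (cotangentModel E) p p)]
      modelJ (coord02 (I := 𝓘(ℝ, E)) g.inner p.1) := by
  have := FiniteDimensional.complete ℝ E
  filter_upwards [extChartAt_target_mem_nhds (I := cotangentModel E) p] with z hz
  exact coord11_J (isInvertible_raw02 g) g.symm
    (fun x z hz ↦ (contDiffAt_coord02_inner g x hz).differentiableAt (by simp)) hz

theorem coord02_cgMetric_eventuallyEq (p : CotangentBundle E M) :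
    coord02 (cgMetric g.inner f) p =ᶠ[𝓝 (extChartAt (cotangentModel E) p p)]
      modelMetric (coord02 (I := 𝓘(ℝ, E)) g.inner p.1) (f ∘ (extChartAt 𝓘(ℝ, E) p.1).symm) := by
  have := FiniteDimensional.complete ℝ E
  filter_upwards [extChartAt_target_mem_nhds (I := cotangentModel E) p] with z hz
  exact coord02_cgMetric (isInvertible_raw02 g) g.symm
    (fun x z hz ↦ (contDiffAt_coord02_inner g x hz).differentiableAt (by simp)) f hz

omit [FiniteDimensional ℝ E] in
theorem extChartAt_cotangent_self (p : CotangentBundle E M) :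
    extChartAt (cotangentModel E) p p = (extChartAt 𝓘(ℝ, E) p.1 p.1, rawCovector p) := by
  rw [extChartAt_cotangent_apply p p (mem_extChartAt_source p.1), tangentCoordChange_diag]
  rfl

omit [FiniteDimensional ℝ E] in
theorem one_add_modelCoInner_ne_zero (p : CotangentBundle E M) :
    1 + modelCoInner (coord02 (I := 𝓘(ℝ, E)) g.inner p.1) (extChartAt (cotangentModel E) p p).1
      (extChartAt (cotangentModel E) p p).2 (extChartAt (cotangentModel E) p p).2 ≠ 0 := by
  rw [extChartAt_cotangent_self, modelCoInner, coord02_self]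
  exact (alpha_pos g p).ne'

theorem isInvertible_coord02_inner (p : CotangentBundle E M) :
    (coord02 (I := 𝓘(ℝ, E)) g.inner p.1 (extChartAt (cotangentModel E) p p).1).IsInvertible := by
  rw [extChartAt_cotangent_self, coord02_self]
  exact isInvertible_raw02 g p.1

omit [FiniteDimensional ℝ E] in
theorem contDiffAt_coord02_inner_fst (p : CotangentBundle E M) :
    ContDiffAt ℝ ∞ (coord02 (I := 𝓘(ℝ, E)) g.inner p.1) (extChartAt (cotangentModel E) p p).1 := by
  rw [extChartAt_cotangent_self]
  exact contDiffAt_coord02_inner g p.1 (mem_extChartAt_target p.1)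

omit [FiniteDimensional ℝ E] in
theorem contDiffAt_comp_extChartAt_symm (hf : ContMDiff 𝓘(ℝ, E) 𝓘(ℝ, ℝ) ∞ f)
    (p : CotangentBundle E M) : ContDiffAt ℝ ∞ (f ∘ (extChartAt 𝓘(ℝ, E) p.1).symm)
      (extChartAt (cotangentModel E) p p).1 := by
  rw [extChartAt_cotangent_self]
  have h := (contMDiffAt_iff.1 (hf p.1)).2
  rwa [ModelWithCorners.range_eq_univ, contDiffWithinAt_univ] at h

theorem contDiffAt_coord11_J (p : CotangentBundle E M) :
    ContDiffAt ℝ ∞ (coord11 (J g.inner) p) (extChartAt (cotangentModel E) p p) := by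
  have := FiniteDimensional.complete ℝ E
  exact (contDiffAt_modelJ (isInvertible_coord02_inner g p)
    (contDiffAt_coord02_inner_fst g p)).congr_of_eventuallyEq (coord11_J_eventuallyEq g p)

theorem contDiffAt_coord02_cgMetric (hf : ContMDiff 𝓘(ℝ, E) 𝓘(ℝ, ℝ) ∞ f)
    (p : CotangentBundle E M) :
    ContDiffAt ℝ ∞ (coord02 (cgMetric g.inner f) p) (extChartAt (cotangentModel E) p p) := by
  have := FiniteDimensional.complete ℝ E
  exact (contDiffAt_modelMetric (isInvertible_coord02_inner g p) (contDiffAt_coord02_inner_fst g p)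
    (one_add_modelCoInner_ne_zero g p)
    (contDiffAt_comp_extChartAt_symm hf p)).congr_of_eventuallyEq (coord02_cgMetric_eventuallyEq g p)

theorem isRiemannianMetric_cgMetric (hf : ContMDiff 𝓘(ℝ, E) 𝓘(ℝ, ℝ) ∞ f)
    (hfpos : ∀ x, 0 < f x) : IsRiemannianMetric (cgMetric g.inner f) :=
  ⟨{ inner := cgMetric g.inner f
     symm := cgMetric_symm g
     pos := cgMetric_self_pos g hfpos
     isVonNBounded := fun p ↦ isVonNBounded_of_pos (V := E × (E →L[ℝ] ℝ))
       (B := raw02 (cgMetric g.inner f) p) (cgMetric_self_pos g hfpos p)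
     contMDiff := contMDiff_of_coord02 (contDiffAt_coord02_cgMetric g hf) }, fun _ ↦ rfl⟩

/-- The eigenspaces are the ranges of the vertical and horizontal lifts, both injective, and a
finite-dimensional space and its dual have equal dimension. -/
theorem finrank_eigenspace_J (h : Tensor02 𝓘(ℝ, E) M) (p : CotangentBundle E M) :
    Module.finrank ℝ (Module.End.eigenspace
      (J h p : TangentSpace (cotangentModel E) p →ₗ[ℝ] TangentSpace (cotangentModel E) p) 1) =
    Module.finrank ℝ (Module.End.eigenspace
      (J h p : TangentSpace (cotangentModel E) p →ₗ[ℝ] TangentSpace (cotangentModel E) p) (-1)) := by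
  have h1 : Module.End.eigenspace
      (J h p : TangentSpace (cotangentModel E) p →ₗ[ℝ] TangentSpace (cotangentModel E) p) 1 =
      LinearMap.range (vLift p : (TangentSpace 𝓘(ℝ, E) p.1 →L[ℝ] ℝ) →ₗ[ℝ] TangentSpace (cotangentModel E) p) := by
    ext ξ
    rw [Module.End.mem_eigenspace_iff, one_smul, LinearMap.mem_range]
    constructor
    · intro hξ
      refine ⟨vPart h p ξ, ?_⟩
      have h0 := hPart_J h p ξ
      have hξ' : J h p ξ = ξ := hξ
      rw [hξ'] at h0
      replace h0 := eq_zero_of_eq_neg h0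
      have := hLift_add_vLift h p ξ
      rwa [h0, map_zero, zero_add] at this
    · rintro ⟨η, rfl⟩
      exact J_vLift h p η
  have h2 : Module.End.eigenspace
      (J h p : TangentSpace (cotangentModel E) p →ₗ[ℝ] TangentSpace (cotangentModel E) p) (-1) =
      LinearMap.range (hLift h p : TangentSpace 𝓘(ℝ, E) p.1 →ₗ[ℝ] TangentSpace (cotangentModel E) p) := by
    ext ξ
    rw [Module.End.mem_eigenspace_iff, neg_one_smul, LinearMap.mem_range]
    constructor
    · intro hξ
      refine ⟨hPart p ξ, ?_⟩
      have h0 := vPart_J h p ξ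
      have hξ' : J h p ξ = -ξ := hξ
      rw [hξ', map_neg] at h0
      replace h0 := eq_zero_of_eq_neg h0.symm
      have := hLift_add_vLift h p ξ
      rwa [h0, map_zero, add_zero] at this
    · rintro ⟨v, rfl⟩
      exact J_hLift h p v
  rw [h1, h2, LinearMap.finrank_range_of_inj, LinearMap.finrank_range_of_inj]
  · change Module.finrank ℝ (E →L[ℝ] ℝ) = Module.finrank ℝ E
    rw [← (LinearMap.toContinuousLinearMap (𝕜 := ℝ) (E := E) (F' := ℝ)).finrank_eq]
    exact Subspace.dual_finrank_eq (K := ℝ) (V := E)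
  · exact Function.LeftInverse.injective (g := hPart p) (hPart_hLift h p)
  · exact Function.LeftInverse.injective (g := vPart h p) (vPart_vLift h p)

theorem isAlmostParacomplex_J [Nontrivial E] : IsAlmostParacomplex (J (M := M) g.inner) where
  smooth := contMDiff_of_coord11 (contDiffAt_coord11_J g)
  sq := J_J g.inner
  ne_id p h := by
    -- Positive dimension provides a nonzero horizontal vector, which J negates; below, a nonzero
    -- covector whose vertical lift J fixes excludes -id.
    obtain ⟨v, hv⟩ : ∃ v : TangentSpace 𝓘(ℝ, E) p.1, v ≠ 0 := exists_ne (0 : E)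
    have h1 := hPart_J g.inner p (hLift g.inner p v)
    rw [h] at h1
    exact hv (eq_zero_of_eq_neg h1)
  ne_neg_id p h := by
    obtain ⟨η, hη⟩ : ∃ η : TangentSpace 𝓘(ℝ, E) p.1 →L[ℝ] ℝ, η ≠ 0 :=
      exists_ne (0 : E →L[ℝ] ℝ)
    have h1 := J_vLift g.inner p η
    rw [h] at h1
    have h2 : -(vLift p η) = vLift p η := h1
    have h3 := congrArg (vPart g.inner p) h2
    rw [map_neg, vPart_vLift] at h3
    exact hη (eq_zero_of_eq_neg h3.symm)
  rank_eq := finrank_eigenspace_J g.inner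

theorem cyclic_phiTerm_cotangent (hf : ContMDiff 𝓘(ℝ, E) 𝓘(ℝ, ℝ) ∞ f)
    (p : CotangentBundle E M) (ξ η ζ : E × (E →L[ℝ] ℝ)) :
    letI z := extChartAt (cotangentModel E) p p
    letI S := phiTerm (coord02 (cgMetric g.inner f) p z) (coord11 (J g.inner) p z)
      (fderiv ℝ (coord02 (cgMetric g.inner f) p) z) (fderiv ℝ (coord11 (J g.inner) p) z)
    S ξ η ζ + S η ζ ξ + S ζ ξ η = 0 := by
  have := FiniteDimensional.complete ℝ E
  have hG := coord02_cgMetric_eventuallyEq g (f := f) p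
  have hJ := coord11_J_eventuallyEq g p
  have hs (y : E) (v w : E) : coord02 (I := 𝓘(ℝ, E)) g.inner p.1 y v w =
      coord02 (I := 𝓘(ℝ, E)) g.inner p.1 y w v :=
    g.symm ((extChartAt 𝓘(ℝ, E) p.1).symm y) _ _
  have key := cyclic_phiTerm_model (isInvertible_coord02_inner g p)
    (contDiffAt_coord02_inner_fst g p) (Filter.Eventually.of_forall hs) (modelVert_symm (hs _))
    (one_add_modelCoInner_ne_zero g p) (contDiffAt_comp_extChartAt_symm hf p) ξ η ζ
  -- The model formulas hold on a neighbourhood of the chart centre, so first derivatives agree as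
  -- well as values.
  rw [← hG.fderiv_eq, ← hJ.fderiv_eq, ← hG.eq_of_nhds, ← hJ.eq_of_nhds] at key
  exact key

end Main

end Cotangent

end

/-! ### The main theorem -/

theorem mainTheorem4
    {E : Type*} [NormedAddCommGroup E] [NormedSpace ℝ E] [FiniteDimensional ℝ E] [Nontrivial E]
    {M : Type*} [TopologicalSpace M] [T2Space M] [SecondCountableTopology M]
    [ChartedSpace E M] [IsManifold 𝓘(ℝ, E) ∞ M]
    (g : ContMDiffRiemannianMetric 𝓘(ℝ, E) ∞ E (fun x : M ↦ TangentSpace 𝓘(ℝ, E) x))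
    (f : M → ℝ) (hf : ContMDiff 𝓘(ℝ, E) 𝓘(ℝ, ℝ) ∞ f) (hfpos : ∀ x, 0 < f x) :
    ManifoldTensor.IsQuasiParaKahlerNorden
        (Cotangent.J g.inner) (Cotangent.cgMetric g.inner f) ∧
    ∀ X Y Z : ManifoldTensor.VField (Cotangent.cotangentModel E) (Cotangent.CotangentBundle E M),
      ManifoldTensor.SmoothVField X → ManifoldTensor.SmoothVField Y →
      ManifoldTensor.SmoothVField Z → ∀ p : Cotangent.CotangentBundle E M,
        ManifoldTensor.PhiOp (Cotangent.J g.inner) (Cotangent.cgMetric g.inner f) X Y Z p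
          + ManifoldTensor.PhiOp (Cotangent.J g.inner) (Cotangent.cgMetric g.inner f) Y Z X p
          + ManifoldTensor.PhiOp (Cotangent.J g.inner) (Cotangent.cgMetric g.inner f) Z X Y p = 0 := by
  have hG (p) := (Cotangent.contDiffAt_coord02_cgMetric g hf p).differentiableAt (by simp)
  have hJ (p) := (Cotangent.contDiffAt_coord11_J g p).differentiableAt (by simp)
  refine ⟨⟨⟨Cotangent.isAlmostParacomplex_J g, Cotangent.isRiemannianMetric_cgMetric g hf hfpos,
    Cotangent.cgMetric_pure g⟩, fun X Y Z hX hY hZ p ↦ ?_⟩, fun X Y Z hX hY hZ p ↦ ?_⟩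
  · rw [ManifoldTensor.cyclic_metric_covDeriv11 (Cotangent.isInvertible_raw02_cgMetric g hfpos p)
      (Cotangent.cgMetric_symm g) (Cotangent.cgMetric_pure g) (hG p) (hJ p)
      (ManifoldTensor.differentiableAt_coordVField hX p)
      (ManifoldTensor.differentiableAt_coordVField hY p)
      (ManifoldTensor.differentiableAt_coordVField hZ p)]
    exact Cotangent.cyclic_phiTerm_cotangent g hf p _ _ _
  · rw [ManifoldTensor.cyclic_PhiOp
      (Cotangent.cgMetric_symm g) (Cotangent.cgMetric_pure g) (hG p) (hJ p)
      (ManifoldTensor.differentiableAt_coordVField hX p)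
      (ManifoldTensor.differentiableAt_coordVField hY p)
      (ManifoldTensor.differentiableAt_coordVField hZ p)]
    exact Cotangent.cyclic_phiTerm_cotangent g hf p _ _ _
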